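/- Let $d\ge 1$ and $\mathbf 1=(1,\dots,1)\in\mathbb R^d$. A map $A:\mathbb R^d\to\mathbb R^d$ (resp. $\phi:\mathbb R^d\to\mathbb R$) is *topical* if it is isotone for the product order and $A(x+a\mathbf 1)=A(x)+a\mathbf 1$ (resp. $\phi(x+a\mathbf 1)=\phi(x)+a$) for all $x\in\mathbb R^d$, $a\in\mathbb R$. Let $Top_d$ be the set of topical operators of $\mathbb R^d$ with the topology of uniform convergence on compact sets. Let $\mathbb{PR}^d$ be the quotient of $\mathbb R^d$ by the relation "$x-y\in\mathbb R\mathbf 1$", with the distance $\delta(\bar x,\bar y)=\max_{i,j}|(x_i-x_j)-(y_i-y_j)|$; $\bar x$ is the class of $x$. Put $E=Top_d\times\mathbb{PR}^d$ with its Borel $\sigma$-algebra. Let $(A(n))_{n\in\mathbb N}$ be an i.i.d. sequence of $Top_d$-valued random variables with the *memory loss property*: there is $N\ge1$ such that, with positive probability, $\overline{A(N)\cdots A(1)x}$ does not depend on $x\in\mathbb R^d$. Let $\phi:\mathbb R^d\to\mathbb R$ be topical, and set $\xi(A,\bar x)=\phi(Ax)-\phi(x)$ and $\sigma(A)=\sup_x|\phi(Ax)-\phi(x)|\in[0,\infty]$.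 Let $Q$ be the transition probability on $E$ given by $Q((A,\bar x),D)=\mathbb P\big((A(1),\overline{Ax})\in D\big)$, let $Q_t(e,dy)=e^{it\xi(y)}Q(e,dy)$ be its Fourier kernels, and let $\mathcal B^\infty$ be the space of functions $(A,\bar x)\mapsto\psi(\overline{Ax})$, where $\psi:\mathbb{PR}^d\to\mathbb C$ is bounded and continuous, with the sup norm. Let $m\in\mathbb N$ and suppose that $\sigma(A(1))$ is almost surely finite and has an $m$-th moment, $\mathbb E[\sigma(A(1))^m]<\infty$. Then $(Q,\xi,\mathcal B^\infty)$ satisfies the Hennion–Hervé condition $\mathcal H(m)$, with $I_0=\mathbb R$ as the interval in (H3); that is, $\xi$ is measurable and: (H1) $\mathcal B^\infty$ is a Banach space of measurable functions on $E$ which contains the constant function $1$ and, with $f$, also $\bar f$ and $|f|$, and on which the evaluations $f\mapsto f(e)$, $e\in E$, are continuous. (H2) (i) There is a $Q$-invariant probability measure $\nu$ on $E$ such that all $f\in\mathcal B^\infty$ are $\nu$-integrable and $f\mapsto\nu(f)$ is continuous on $\mathcal B^\infty$; (ii) $f\mapsto Qf=\int f(y)\,Q(\cdot,dy)$ is a bounded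 operator on $\mathcal B^\infty$ with $\sup_n\|Q^n\|<\infty$, and it is quasi-compact: $\mathcal B^\infty=F\oplus H$ with closed $Q$-invariant subspaces $F,H$ such that $\dim F<\infty$, every eigenvalue of $Q|_F$ has modulus $r(Q)$, and $r(Q|_H)<r(Q)$, where $r$ is the spectral radius; (iii) $\dim\ker(1-Q)=1$. (H3) For all $t\in I_0=\mathbb R$, $Q_t$ is a bounded operator on $\mathcal B^\infty$, and $t\mapsto Q_t$ is of class $C^m$ from $\mathbb R$ to the space of bounded operators on $\mathcal B^\infty$ with the operator norm. Moreover $r(Q)=1$, and $s(Q,\mathcal B^\infty)=1$, where $s(Q,\mathcal B^\infty)$ is the dimension of the sum of the generalized eigenspaces of $Q$ on $\mathcal B^\infty$ for the eigenvalues of modulus $r(Q)$. -/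

import Mathlib

open MeasureTheory ProbabilityTheory
open scoped ENNReal BoundedContinuousFunction

noncomputable section

namespace IteratedTopical

/-! ### Topical operators and the projective space -/

/-- A topical function `ℝ^d → ℝ`: isotone and additively homogeneous. -/
structure IsTopicalFunction {d : ℕ} (φ : (Fin d → ℝ) → ℝ) : Prop where
  isotone : ∀ x y : Fin d → ℝ, x ≤ y → φ x ≤ φ y
  homogeneous : ∀ (x : Fin d → ℝ) (a : ℝ), φ (fun i => x i + a) = φ x + a

/-- The set `Top_d` of topical operators of `ℝ^d`: isotone and additively homogeneous maps. -/
structure TopicalOperator (d : ℕ) where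
  toFun : (Fin d → ℝ) → (Fin d → ℝ)
  isotone : ∀ x y : Fin d → ℝ, x ≤ y → toFun x ≤ toFun y
  homogeneous : ∀ (x : Fin d → ℝ) (a : ℝ), toFun (fun i => x i + a) = fun i => toFun x i + a

instance (d : ℕ) : CoeFun (TopicalOperator d) (fun _ => (Fin d → ℝ) → (Fin d → ℝ)) :=
  ⟨TopicalOperator.toFun⟩

namespace TopicalOperator

variable {d : ℕ}

theorem apply_le (A : TopicalOperator d) (x y : Fin d → ℝ) (i : Fin d) :
    A x i ≤ A y i + dist x y := by
  have h : x ≤ fun j => y j + dist x y := by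
    intro j
    have h1 := dist_le_pi_dist x y j
    rw [Real.dist_eq] at h1
    have h2 := le_abs_self (x j - y j)
    show x j ≤ y j + dist x y
    linarith
  have h3 := A.isotone _ _ h i
  rw [A.homogeneous] at h3
  exact h3

/-- Topical operators are non-expanding for the sup norm. -/
theorem lipschitz (A : TopicalOperator d) : LipschitzWith 1 A.toFun := by
  refine LipschitzWith.of_dist_le_mul fun x y => ?_
  rw [NNReal.coe_one, one_mul, dist_pi_le_iff dist_nonneg]
  intro i
  rw [Real.dist_eq, abs_le]
  have h1 := A.apply_le x y i
  have h2 := A.apply_le y x i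
  rw [dist_comm y x] at h2
  constructor <;> linarith

/-- A topical operator as a continuous map. -/
def toContinuousMap (A : TopicalOperator d) : C(Fin d → ℝ, Fin d → ℝ) :=
  ⟨A.toFun, A.lipschitz.continuous⟩

/-- The topology of uniform convergence on compact sets (the compact-open topology). -/
instance : TopologicalSpace (TopicalOperator d) :=
  TopologicalSpace.induced toContinuousMap inferInstance

instance : MeasurableSpace (TopicalOperator d) := borel _

instance : BorelSpace (TopicalOperator d) := ⟨rfl⟩

theorem isInducing_toContinuousMap :
    Topology.IsInducing (toContinuousMap : TopicalOperator d → C(Fin d → ℝ, Fin d → ℝ)) :=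
  ⟨rfl⟩

instance : SecondCountableTopology (TopicalOperator d) :=
  isInducing_toContinuousMap.secondCountableTopology

theorem continuous_eval :
    Continuous (fun p : TopicalOperator d × (Fin d → ℝ) => p.1 p.2) := by
  have h : Continuous (fun p : TopicalOperator d × (Fin d → ℝ) => p.1.toContinuousMap p.2) :=
    (isInducing_toContinuousMap.continuous.comp continuous_fst).eval continuous_snd
  exact h

/-- The identity operator. -/
def id (d : ℕ) : TopicalOperator d := ⟨fun x => x, fun _ _ h => h, fun _ _ => rfl⟩

/-- Composition of topical operators, `A.comp B = AB`. -/
def comp (A B : TopicalOperator d) : TopicalOperator d where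
  toFun x := A (B x)
  isotone x y h := A.isotone _ _ (B.isotone x y h)
  homogeneous x a := by rw [B.homogeneous, A.homogeneous]

end TopicalOperator

/-- `x ∼ y` if `x - y` is proportional to the vector `(1, …, 1)`. -/
def projSetoid (d : ℕ) : Setoid (Fin d → ℝ) where
  r x y := ∃ c : ℝ, ∀ i, x i - y i = c
  iseqv :=
    { refl := fun x => ⟨0, fun i => sub_self _⟩
      symm := fun ⟨c, hc⟩ => ⟨-c, fun i => by have := hc i; linarith⟩
      trans := fun ⟨c, hc⟩ ⟨c', hc'⟩ =>
        ⟨c + c', fun i => by have := hc i; have := hc' i; linarith⟩ }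

/-- The projective space: the quotient of `ℝ^d` by translations along `(1, …, 1)`. -/
def ProjSpace (d : ℕ) : Type := Quotient (projSetoid d)

namespace ProjSpace

variable {d : ℕ}

/-- The class of `x`. -/
def mk (x : Fin d → ℝ) : ProjSpace d := Quotient.mk (projSetoid d) x

theorem mk_eq_mk {x y : Fin d → ℝ} : mk x = mk y ↔ ∃ c : ℝ, ∀ i, x i - y i = c :=
  ⟨fun h => Quotient.exact h, fun h => Quotient.sound h⟩

/-- The embedding sending the class of `x` to the family of differences `x i - x j`. -/
def diff : ProjSpace d → (Fin d → Fin d → ℝ) :=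
  Quotient.lift (fun (x : Fin d → ℝ) i j => x i - x j) (by
    rintro x y ⟨c, hc⟩
    funext i j
    have := hc i
    have := hc j
    show x i - x j = y i - y j
    linarith)

theorem diff_injective : Function.Injective (diff : ProjSpace d → (Fin d → Fin d → ℝ)) := by
  intro a b
  refine Quotient.inductionOn₂ a b fun x y h => Quotient.sound ?_
  rcases Nat.eq_zero_or_pos d with rfl | hd
  · exact ⟨0, fun i => i.elim0⟩
  · refine ⟨x ⟨0, hd⟩ - y ⟨0, hd⟩, fun i => ?_⟩
    have h1 : x i - x ⟨0, hd⟩ = y i - y ⟨0, hd⟩ := congrFun (congrFun h i) ⟨0, hd⟩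
    linarith

/-- The distance `δ` induced by the sup norm through the embedding `diff`. -/
instance : MetricSpace (ProjSpace d) := MetricSpace.induced diff diff_injective inferInstance

instance : MeasurableSpace (ProjSpace d) := borel _

instance : BorelSpace (ProjSpace d) := ⟨rfl⟩

theorem isInducing_diff :
    Topology.IsInducing (diff : ProjSpace d → (Fin d → Fin d → ℝ)) := ⟨rfl⟩

instance : SecondCountableTopology (ProjSpace d) := isInducing_diff.secondCountableTopology

theorem continuous_mk : Continuous (mk : (Fin d → ℝ) → ProjSpace d) := by
  rw [isInducing_diff.continuous_iff]
  have h : Continuous (fun (x : Fin d → ℝ) (i j : Fin d) => x i - x j) := by fun_prop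
  exact h

/-- A continuous choice of representatives (the one whose coordinates sum to `0`). -/
def repr (a : ProjSpace d) : Fin d → ℝ := fun i => (∑ j, diff a i j) / d

theorem continuous_repr : Continuous (repr : ProjSpace d → (Fin d → ℝ)) := by
  have h : Continuous (fun (a : Fin d → Fin d → ℝ) (i : Fin d) => (∑ j, a i j) / (d : ℝ)) := by
    fun_prop
  exact h.comp isInducing_diff.continuous

theorem mk_repr (a : ProjSpace d) : mk (repr a) = a := by
  refine Quotient.inductionOn a fun x => ?_
  refine mk_eq_mk.2 ⟨-((∑ j, x j) / d), fun i => ?_⟩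
  have hd : (d : ℝ) ≠ 0 := by
    have := i.pos
    positivity
  show (∑ j, (x i - x j)) / (d : ℝ) - x i = -((∑ j, x j) / d)
  rw [Finset.sum_sub_distrib]
  simp only [Finset.sum_const, Finset.card_univ, Fintype.card_fin, nsmul_eq_mul]
  field_simp
  ring

end ProjSpace

/-- The action of a topical operator on the projective space. -/
def TopicalOperator.proj {d : ℕ} (A : TopicalOperator d) : ProjSpace d → ProjSpace d :=
  Quotient.lift (fun x => ProjSpace.mk (A x)) (by
    rintro x y ⟨c, hc⟩
    have hx : x = fun i => y i + c := by
      funext i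
      have := hc i
      linarith
    refine ProjSpace.mk_eq_mk.2 ⟨c, fun i => ?_⟩
    rw [hx, A.homogeneous]
    ring)

/-- A topical operator has rank one if the class of `A x` does not depend on `x`. -/
def TopicalOperator.IsRankOne {d : ℕ} (A : TopicalOperator d) : Prop :=
  ∀ x y : Fin d → ℝ, ProjSpace.mk (A x) = ProjSpace.mk (A y)

/-- The product `A n ⋯ A 1`. -/
def productUpTo {d : ℕ} (A : ℕ → TopicalOperator d) : ℕ → TopicalOperator d
  | 0 => TopicalOperator.id d
  | n + 1 => (A (n + 1)).comp (productUpTo A n)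

/-- Memory loss property of a random sequence of topical operators. -/
def MemoryLossProperty {Ω : Type*} [MeasurableSpace Ω] {d : ℕ} (P : Measure Ω)
    (A : ℕ → Ω → TopicalOperator d) : Prop :=
  ∃ N : ℕ, 1 ≤ N ∧ 0 < P {ω | (productUpTo (fun n => A n ω) N).IsRankOne}

/-! ### The Markov chain and the function space -/

/-- The state space `E = Top_d × ℙℝ^d`; its product σ-algebra is the Borel σ-algebra. -/
abbrev StateSpace (d : ℕ) : Type := TopicalOperator d × ProjSpace d

/-- `j (A, x̄)` is the class of `A x`. -/
def jMap {d : ℕ} (p : StateSpace d) : ProjSpace d := p.1.proj p.2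

theorem continuous_jMap {d : ℕ} : Continuous (jMap : StateSpace d → ProjSpace d) := by
  have h : (jMap : StateSpace d → ProjSpace d) =
      fun p => ProjSpace.mk (p.1 (ProjSpace.repr p.2)) := by
    funext p
    show p.1.proj p.2 = p.1.proj (ProjSpace.mk (ProjSpace.repr p.2))
    rw [ProjSpace.mk_repr]
  rw [h]
  exact ProjSpace.continuous_mk.comp (TopicalOperator.continuous_eval.comp
    (continuous_fst.prodMk (ProjSpace.continuous_repr.comp continuous_snd)))

/-- The transition probability: `Q (A, x̄)` is the law of `(B, class of A x)`, where `B` has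
law `μ`. -/
def transitionKernel {d : ℕ} (μ : Measure (TopicalOperator d)) [SFinite μ] :
    Kernel (StateSpace d) (StateSpace d) :=
  Kernel.const (StateSpace d) μ ×ₖ Kernel.deterministic jMap continuous_jMap.measurable

/-- Formula for the transition probability. -/
theorem transitionKernel_apply {Ω : Type*} [MeasurableSpace Ω] {d : ℕ} (P : Measure Ω)
    [IsProbabilityMeasure P] (B : Ω → TopicalOperator d) (hB : Measurable B)
    (p : StateSpace d) (D : Set (StateSpace d)) (hD : MeasurableSet D) :
    transitionKernel (P.map B) p D = P {ω | (B ω, jMap p) ∈ D} := by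
  have : IsProbabilityMeasure (P.map B) := Measure.isProbabilityMeasure_map hB.aemeasurable
  rw [transitionKernel, Kernel.prod_apply, Kernel.const_apply, Kernel.deterministic_apply,
    Measure.prod_dirac, Measure.map_apply (by fun_prop) hD,
    Measure.map_apply hB (measurable_prodMk_right hD)]
  rfl

/-- The cocycle `ξ (A, x̄) = φ (A x) - φ x`. -/
def cocycle {d : ℕ} (φ : (Fin d → ℝ) → ℝ) (hφ : IsTopicalFunction φ) (p : StateSpace d) : ℝ :=
  Quotient.lift (fun x => φ (p.1 x) - φ x) (by
    rintro x y ⟨c, hc⟩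
    have hx : x = fun i => y i + c := by
      funext i
      have := hc i
      linarith
    show φ (p.1 x) - φ x = φ (p.1 y) - φ y
    rw [hx, p.1.homogeneous, hφ.homogeneous, hφ.homogeneous]
    ring) p.2

/-- `σ(A) = sup_x |φ (A x) - φ x|`, as an element of `[0, ∞]`. -/
def supCocycle {d : ℕ} (φ : (Fin d → ℝ) → ℝ) (A : TopicalOperator d) : ℝ≥0∞ :=
  ⨆ x : Fin d → ℝ, ENNReal.ofReal |φ (A x) - φ x|

/-- A `[0, ∞]`-valued random variable is almost surely finite and has a moment of order `m`. -/
def HasMoment {Ω : Type*} [MeasurableSpace Ω] (P : Measure Ω) (X : Ω → ℝ≥0∞) (m : ℕ) : Prop :=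
  (∀ᵐ ω ∂P, X ω < ∞) ∧ ∫⁻ ω, X ω ^ m ∂P < ∞

/-- The map `ψ ↦ ψ ∘ j` from bounded continuous functions on the projective space to bounded
functions on the state space. -/
def compJ (d : ℕ) : (ProjSpace d →ᵇ ℂ) →ₗ[ℂ] (StateSpace d →ᵇ ℂ) where
  toFun ψ := ψ.compContinuous ⟨jMap, continuous_jMap⟩
  map_add' _ _ := rfl
  map_smul' _ _ := rfl

/-- The space `𝓑^∞` of functions `ψ ∘ j`, `ψ` bounded and continuous on the projective space,
with the sup norm. -/
abbrev BInfty (d : ℕ) : Submodule ℂ (StateSpace d →ᵇ ℂ) := LinearMap.range (compJ d)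

/-- Elements of `𝓑^∞` as functions on the state space. -/
def bInftyFun (d : ℕ) : BInfty d →ₗ[ℂ] (StateSpace d → ℂ) where
  toFun f := fun p => (f : StateSpace d →ᵇ ℂ) p
  map_add' _ _ := rfl
  map_smul' _ _ := rfl

/-! ### The Hennion–Hervé condition

Here `E` is a measurable space, `Q` a transition probability on `E`, `ξ` a real function on `E`,
and `B` a normed space of functions on `E`, the map `ι` sending an element of `B` to the
corresponding function. -/

section HennionHerve

variable {E : Type*} [MeasurableSpace E] {B : Type*} [NormedAddCommGroup B] [NormedSpace ℂ B]

/-- `T` is the operator `f ↦ ∫ f(y) Q(·, dy)` on `B`. -/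
def IsMarkovOperator (Q : Kernel E E) (ι : B →ₗ[ℂ] (E → ℂ)) (T : B →L[ℂ] B) : Prop :=
  ∀ (f : B) (x : E), Integrable (ι f) (Q x) ∧ ι (T f) x = ∫ y, ι f y ∂(Q x)

/-- `T` is the operator on `B` given by the Fourier kernel `Q_t(x, dy) = e^{i t ξ(y)} Q(x, dy)`. -/
def IsFourierOperator (Q : Kernel E E) (ξ : E → ℝ) (ι : B →ₗ[ℂ] (E → ℂ)) (t : ℂ)
    (T : B →L[ℂ] B) : Prop :=
  ∀ (f : B) (x : E),
    Integrable (fun y => Complex.exp (Complex.I * t * (ξ y : ℂ)) * ι f y) (Q x) ∧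
      ι (T f) x = ∫ y, Complex.exp (Complex.I * t * (ξ y : ℂ)) * ι f y ∂(Q x)

/-- Quasi-compactness: `B` is the direct sum of two closed invariant subspaces `F` and `H`, where
`F` is finite dimensional, all eigenvalues of `T` on `F` have modulus `r(T)`, and the spectral
radius of `T` on `H` is less than `r(T)`. -/
def IsQuasiCompact (T : B →L[ℂ] B) : Prop :=
  ∃ (F H : Submodule ℂ B) (_ : ∀ f ∈ F, T f ∈ F) (hH : ∀ f ∈ H, T f ∈ H),
    IsCompl F H ∧ IsClosed (F : Set B) ∧ IsClosed (H : Set B) ∧ FiniteDimensional ℂ F ∧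
      (∀ (z : ℂ), ∀ f ∈ F, f ≠ 0 → T f = z • f → ENNReal.ofReal ‖z‖ = spectralRadius ℂ T) ∧
      spectralRadius ℂ (T.restrict hH) < spectralRadius ℂ T

/-- `s(T)`: the dimension of the sum of the generalized eigenspaces of `T` for the eigenvalues
whose modulus is the spectral radius. -/
def peripheralDim (T : B →L[ℂ] B) : ℕ :=
  Module.finrank ℂ ↥(⨆ (z : ℂ) (_ : ENNReal.ofReal ‖z‖ = spectralRadius ℂ T),
    Module.End.maxGenEigenspace (T : B →ₗ[ℂ] B) z)

/-- (H1): `B` is a Banach space of measurable functions that contains the constants, is stable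
under conjugation and modulus, and on which all evaluations are continuous. -/
structure ConditionH1 (ι : B →ₗ[ℂ] (E → ℂ)) : Prop where
  injective : Function.Injective ι
  complete : CompleteSpace B
  measurable : ∀ f, Measurable (ι f)
  one_mem : ∃ g, ι g = fun _ => 1
  conj_mem : ∀ f, ∃ g, ι g = fun x => star (ι f x)
  abs_mem : ∀ f, ∃ g, ι g = fun x => (‖ι f x‖ : ℂ)
  dirac_continuous : ∀ x, Continuous fun f => ι f x

/-- (H2): `Q` has an invariant probability measure that is a continuous linear form on `B`, it
acts on `B` as a quasi-compact operator with bounded iterates, and `Ker (1 - Q)` is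
one-dimensional. -/
def ConditionH2 (Q : Kernel E E) (ι : B →ₗ[ℂ] (E → ℂ)) : Prop :=
  (∃ ν : Measure E, IsProbabilityMeasure ν ∧ Q.Invariant ν ∧ (∀ f, Integrable (ι f) ν) ∧
    Continuous fun f => ∫ x, ι f x ∂ν) ∧
  ∃ T : B →L[ℂ] B, IsMarkovOperator Q ι T ∧
    IsQuasiCompact T ∧ (∃ C : ℝ, ∀ n : ℕ, ‖T ^ n‖ ≤ C) ∧
    Module.finrank ℂ (Module.End.eigenspace (T : B →ₗ[ℂ] B) 1) = 1

/-- (H3) on `I₀`: the Fourier kernels `Q_t`, `t ∈ I₀`, are bounded operators on `B`, and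
`t ↦ Q_t` is of class `C^m` on `I₀` for the operator norm. -/
def ConditionH3 (Q : Kernel E E) (ξ : E → ℝ) (ι : B →ₗ[ℂ] (E → ℂ)) (m : ℕ) (I₀ : Set ℝ) : Prop :=
  ∃ T : ℝ → (B →L[ℂ] B), (∀ t ∈ I₀, IsFourierOperator Q ξ ι (t : ℂ) (T t)) ∧
    ContDiffOn ℝ (m : WithTop ℕ∞) T I₀

/-- The condition `𝓗(m)` for `(Q, ξ, B)`, with `I₀` as the interval in (H3). -/
structure ConditionHWith (Q : Kernel E E) (ξ : E → ℝ) (ι : B →ₗ[ℂ] (E → ℂ)) (m : ℕ)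
    (I₀ : Set ℝ) : Prop where
  markov : IsMarkovKernel Q
  measurable : Measurable ξ
  h1 : ConditionH1 ι
  h2 : ConditionH2 Q ι
  isOpen : IsOpen I₀
  interval : I₀.OrdConnected
  zero_mem : (0 : ℝ) ∈ I₀
  h3 : ConditionH3 Q ξ ι m I₀

/-- The condition `𝓗(m)` for `(Q, ξ, B)`. -/
def ConditionH (Q : Kernel E E) (ξ : E → ℝ) (ι : B →ₗ[ℂ] (E → ℂ)) (m : ℕ) : Prop :=
  ∃ I₀ : Set ℝ, ConditionHWith Q ξ ι m I₀

end HennionHerve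

end IteratedTopical

end

open MeasureTheory ProbabilityTheory
open scoped ENNReal BoundedContinuousFunction

noncomputable section

/-! Write `μ` for the law of `A 1`. The map `ψ ↦ ψ ∘ jMap` is an isometry of the bounded continuous
functions on the projective space onto `BInfty`. It conjugates `Q` to `ψ ↦ ∫ ψ (B ·) μ(dB)` and
`Q_t` to the same operator weighted by `e^{itξ}`, so the analysis takes place on the projective
space.

Spectral gap. Suppose `A N ⋯ A 1` has rank one with probability `p > 0`. A rank one operator sends
any two points to the same point, so the `N`-th iterate multiplies the oscillation of a function by
at most `1 - p` (`norm_integral_sub_le_of_osc`). On functions of zero mean for an invariant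
probability, the sup norm is at most the oscillation. Some iterate is therefore a strict contraction
on this closed hyperplane, which is a complement of the constants (`hasSpectralGap_liftOperator`).
Quasi-compactness, simplicity of the eigenvalue `1` and the absence of any other peripheral spectrum
then follow by linear algebra and `r(S) ≤ ‖S^n‖^{1/n}` (`HasSpectralGap`).

Invariant probability. No compactness is available. For the law of the `N`-fold product, the rank
one part forgets the initial point, so stationarity becomes an affine equation, solved by a Neumann
series (`exists_act_eq_self_of_isRankOne`). Averaging over one period of length `N` gives
stationarity for `μ`.

Regularity in `t`. The formal derivatives of `Q_t` have weights `(iξ)^k e^{itξ}`, bounded by `σ^k`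
uniformly in the projective variable. Their increments and first order Taylor remainders are
controlled in operator norm by `∫ σ^k · 2 min(1, |h| σ) dμ`, which tends to `0` with `h` by
dominated convergence for `k ≤ m` (`contDiff_of_modulus`). -/

namespace IteratedTopical

/-! ### Operators with a spectral gap -/

section SpectralGap

variable {B : Type*} [NormedAddCommGroup B] [NormedSpace ℂ B]

/-- `T` is a contraction fixing `e` and the linear form `ℓ`, with `ℓ e = 1`, and some power of `T`
is a strict contraction on the kernel of `ℓ`. -/
structure HasSpectralGap (T : B →L[ℂ] B) (e : B) (ℓ : B →L[ℂ] ℂ) : Prop where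
  norm_le : ‖T‖ ≤ 1
  map_fixed : T e = e
  form_fixed : ℓ e = 1
  form_map : ∀ f, ℓ (T f) = ℓ f
  contract : ∃ (n : ℕ) (c : ℝ), c < 1 ∧ ∀ h, ℓ h = 0 → ‖(T ^ n) h‖ ≤ c * ‖h‖

namespace HasSpectralGap

variable {T : B →L[ℂ] B} {e : B} {ℓ : B →L[ℂ] ℂ}

theorem fixed_ne_zero (hT : HasSpectralGap T e ℓ) : e ≠ 0 := by
  rintro rfl
  simpa using hT.form_fixed

theorem map_ker (hT : HasSpectralGap T e ℓ) {h : B} (hh : h ∈ ℓ.ker) : T h ∈ ℓ.ker := by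
  rw [LinearMap.mem_ker] at hh ⊢
  exact (hT.form_map h).trans hh

theorem norm_pow_le (hT : HasSpectralGap T e ℓ) (n : ℕ) : ‖T ^ n‖ ≤ 1 := by
  induction n with
  | zero => exact ContinuousLinearMap.norm_id_le
  | succ n ih =>
    rw [pow_succ]
    exact (norm_mul_le _ _).trans (mul_le_one₀ ih (norm_nonneg _) hT.norm_le)

theorem pow_apply_of_map_eq {T : B →L[ℂ] B} {z : ℂ} {f : B} (h : T f = z • f) (n : ℕ) :
    (T ^ n) f = z ^ n • f := by
  induction n with
  | zero => simp
  | succ n ih => rw [pow_succ, mul_apply_eq_comp, h, map_smul, ih, smul_smul, pow_succ']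

/-- All powers of `T` preserve the norm of such an eigenvector, against the strict contraction. -/
theorem eq_zero_of_map_eq_smul (hT : HasSpectralGap T e ℓ) {z : ℂ} (hz : ‖z‖ = 1) {h : B}
    (hh : ℓ h = 0) (hTh : T h = z • h) : h = 0 := by
  obtain ⟨n, c, hc, hn⟩ := hT.contract
  have h1 := hn h hh
  rw [pow_apply_of_map_eq hTh, norm_smul, norm_pow, hz, one_pow, one_mul] at h1
  by_contra h0
  have : 0 < ‖h‖ := norm_pos_iff.2 h0
  nlinarith

theorem one_mem_spectrum (hT : HasSpectralGap T e ℓ) : (1 : ℂ) ∈ spectrum ℂ T := by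
  rw [spectrum.mem_iff, map_one]
  rintro ⟨u, hu⟩
  apply hT.fixed_ne_zero
  have h1 : (u : B →L[ℂ] B) e = 0 := by rw [hu]; simp [hT.map_fixed]
  have h2 : ((↑u⁻¹ * ↑u : B →L[ℂ] B)) e = 0 := by
    rw [mul_apply_eq_comp, h1, map_zero]
  rwa [Units.inv_mul, one_apply_eq_self] at h2

theorem spectralRadius_eq_one [CompleteSpace B] (hT : HasSpectralGap T e ℓ) :
    spectralRadius ℂ T = 1 := by
  have : Nontrivial B := ⟨e, 0, hT.fixed_ne_zero⟩
  apply le_antisymm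
  · refine (spectrum.spectralRadius_le_nnnorm T).trans ?_
    exact_mod_cast hT.norm_le
  · have := le_iSup₂ (f := fun (k : ℂ) (_ : k ∈ spectrum ℂ T) => (‖k‖₊ : ℝ≥0∞)) 1
      hT.one_mem_spectrum
    simpa [spectralRadius] using this

theorem restrict_pow_apply (hH : ∀ h ∈ ℓ.ker, T h ∈ ℓ.ker) (n : ℕ) (h : ℓ.ker) :
    (((T.restrict hH) ^ n) h : B) = (T ^ n) h := by
  induction n generalizing h with
  | zero => rfl
  | succ n ih =>
    rw [pow_succ, pow_succ, mul_apply_eq_comp, mul_apply_eq_comp, ih]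
    rfl

theorem spectralRadius_restrict_lt_one [CompleteSpace B] (hT : HasSpectralGap T e ℓ)
    (hH : ∀ h ∈ ℓ.ker, T h ∈ ℓ.ker) : spectralRadius ℂ (T.restrict hH) < 1 := by
  have : CompleteSpace ℓ.ker := (ContinuousLinearMap.isClosed_ker ℓ).completeSpace_coe
  obtain ⟨n, c, hc, hn⟩ := hT.contract
  set S := T.restrict hH
  -- The constant `c` may be negative when the kernel is trivial, hence the maximum with `0`.
  have hS : ‖S ^ n‖ ≤ max c 0 := by
    refine ContinuousLinearMap.opNorm_le_bound _ (le_max_right _ _) fun h => ?_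
    rw [← Submodule.norm_coe, restrict_pow_apply]
    exact (hn _ h.2).trans (mul_le_mul_of_nonneg_right (le_max_left _ _) (norm_nonneg _))
  rcases subsingleton_or_nontrivial (ℓ.ker) with hs | hs
  · rw [spectrum.SpectralRadius.of_subsingleton]
    exact zero_lt_one
  -- On a nontrivial space `S ^ 0` has norm `1`, so the contracting power is positive and an `n`-th
  -- root can be taken.
  have hn0 : n ≠ 0 := by
    rintro rfl
    rw [pow_zero, norm_one] at hS
    exact absurd hS (not_le.2 (max_lt hc zero_lt_one))
  obtain ⟨k, rfl⟩ := Nat.exists_eq_succ_of_ne_zero hn0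
  refine (spectrum.spectralRadius_le_pow_nnnorm_pow_one_div ℂ S k).trans_lt ?_
  have h1 : (‖S ^ (k + 1)‖₊ : ℝ≥0∞) < 1 := by
    exact_mod_cast hS.trans_lt (max_lt hc zero_lt_one)
  rw [nnnorm_one, ENNReal.coe_one, ENNReal.one_rpow, mul_one]
  exact ENNReal.rpow_lt_one h1 (by positivity)

theorem isCompl (hT : HasSpectralGap T e ℓ) : IsCompl (ℂ ∙ e) ℓ.ker := by
  rw [isCompl_iff, Submodule.disjoint_def, codisjoint_iff_le_sup]
  refine ⟨fun x hx hx' => ?_, fun x _ => ?_⟩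
  · obtain ⟨a, rfl⟩ := Submodule.mem_span_singleton.1 hx
    have : a = 0 := by simpa [hT.form_fixed] using hx'
    rw [this, zero_smul]
  · rw [Submodule.mem_sup]
    refine ⟨ℓ x • e, Submodule.smul_mem _ _ (Submodule.mem_span_singleton_self e), x - ℓ x • e,
      ?_, by abel⟩
    simp [hT.form_fixed]

theorem isQuasiCompact [CompleteSpace B] (hT : HasSpectralGap T e ℓ) : IsQuasiCompact T := by
  refine ⟨ℂ ∙ e, ℓ.ker, ?_, fun h hh => hT.map_ker hh, hT.isCompl,
    Submodule.closed_of_finiteDimensional _, ContinuousLinearMap.isClosed_ker ℓ, inferInstance,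
    ?_, ?_⟩
  · intro f hf
    obtain ⟨a, rfl⟩ := Submodule.mem_span_singleton.1 hf
    rwa [map_smul, hT.map_fixed]
  · intro z f hf hf0 hTf
    obtain ⟨a, rfl⟩ := Submodule.mem_span_singleton.1 hf
    rw [map_smul, hT.map_fixed] at hTf
    have hz : z = 1 := by
      have h1 : (1 - z) • (a • e) = 0 := by rw [sub_smul, one_smul, ← hTf, sub_self]
      have h2 := (smul_eq_zero.1 h1).resolve_right hf0
      exact (sub_eq_zero.1 h2).symm
    rw [hT.spectralRadius_eq_one, hz]
    simp
  · rw [hT.spectralRadius_eq_one]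
    exact hT.spectralRadius_restrict_lt_one _

theorem form_sub_smul_pow (hT : HasSpectralGap T e ℓ) (z : ℂ) (k : ℕ) (f : B) :
    ℓ ((((T : B →ₗ[ℂ] B) - algebraMap ℂ (Module.End ℂ B) z) ^ k) f) = (1 - z) ^ k * ℓ f := by
  induction k generalizing f with
  | zero => simp
  | succ k ih =>
    rw [pow_succ, Module.End.mul_apply, ih, LinearMap.sub_apply, Module.algebraMap_end_apply,
      ContinuousLinearMap.coe_coe, map_sub, hT.form_map, map_smul, smul_eq_mul]
    ring

theorem sub_smul_pow_fixed (hT : HasSpectralGap T e ℓ) (z : ℂ) (k : ℕ) :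
    (((T : B →ₗ[ℂ] B) - algebraMap ℂ (Module.End ℂ B) z) ^ k) e = (1 - z) ^ k • e := by
  induction k with
  | zero => simp
  | succ k ih =>
    rw [pow_succ, Module.End.mul_apply, LinearMap.sub_apply, Module.algebraMap_end_apply,
      ContinuousLinearMap.coe_coe, hT.map_fixed]
    rw [map_sub, map_smul, ih, pow_succ, mul_comm, mul_smul, sub_smul, one_smul]

/-- `T - z` preserves the kernel of `ℓ` and is injective there, hence so are its powers. This
excludes generalized eigenvectors in that kernel. -/
theorem eq_zero_of_sub_smul_pow_eq_zero (hT : HasSpectralGap T e ℓ) {z : ℂ} (hz : ‖z‖ = 1)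
    (k : ℕ) {h : B} (hh : ℓ h = 0)
    (hk : (((T : B →ₗ[ℂ] B) - algebraMap ℂ (Module.End ℂ B) z) ^ k) h = 0) : h = 0 := by
  induction k generalizing h with
  | zero => simpa using hk
  | succ k ih =>
    rw [pow_succ, Module.End.mul_apply] at hk
    have h1 := ih (by
      rw [LinearMap.sub_apply, Module.algebraMap_end_apply, ContinuousLinearMap.coe_coe, map_sub,
        hT.form_map, map_smul, hh, smul_zero, sub_zero]) hk
    rw [LinearMap.sub_apply, Module.algebraMap_end_apply, ContinuousLinearMap.coe_coe,
      sub_eq_zero] at h1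
    exact hT.eq_zero_of_map_eq_smul hz hh h1

/-- If `(T - z)^k f = 0`, applying `ℓ` gives `(1 - z)^k ℓ f = 0`, so `(T - z)^k` also kills `ℓ f •
e`. It then kills `f - ℓ f • e`, which lies in the kernel of `ℓ` and must vanish. The case `z = 1`
needs no separate treatment. -/
theorem maxGenEigenspace_le (hT : HasSpectralGap T e ℓ) {z : ℂ} (hz : ‖z‖ = 1) :
    Module.End.maxGenEigenspace (T : B →ₗ[ℂ] B) z ≤ ℂ ∙ e := by
  intro f hf
  obtain ⟨k, hk⟩ := Module.End.mem_maxGenEigenspace _ _ _ |>.1 hf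
  replace hk : (((T : B →ₗ[ℂ] B) - algebraMap ℂ (Module.End ℂ B) z) ^ k) f = 0 := hk
  have h1 : f - ℓ f • e = 0 := by
    refine hT.eq_zero_of_sub_smul_pow_eq_zero hz k (by simp [hT.form_fixed]) ?_
    have h2 := hT.form_sub_smul_pow z k f
    rw [hk, map_zero] at h2
    rw [map_sub, map_smul, hk, hT.sub_smul_pow_fixed, smul_smul, mul_comm, ← h2]
    simp
  rw [sub_eq_zero.1 h1]
  exact Submodule.smul_mem _ _ (Submodule.mem_span_singleton_self e)

theorem eigenspace_le_maxGenEigenspace (T : B →L[ℂ] B) (z : ℂ) :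
    Module.End.eigenspace (T : B →ₗ[ℂ] B) z ≤ Module.End.maxGenEigenspace (T : B →ₗ[ℂ] B) z := by
  intro f hf
  rw [Module.End.mem_eigenspace_iff] at hf
  refine (Module.End.mem_maxGenEigenspace _ _ _).2 ⟨1, ?_⟩
  rw [pow_one, LinearMap.sub_apply, hf]
  simp

theorem eigenspace_one (hT : HasSpectralGap T e ℓ) :
    Module.End.eigenspace (T : B →ₗ[ℂ] B) 1 = ℂ ∙ e := by
  apply le_antisymm
  · exact (eigenspace_le_maxGenEigenspace T 1).trans (hT.maxGenEigenspace_le (by simp))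
  · rw [Submodule.span_singleton_le_iff_mem, Module.End.mem_eigenspace_iff]
    rw [one_smul]
    exact hT.map_fixed

theorem finrank_eigenspace_one (hT : HasSpectralGap T e ℓ) :
    Module.finrank ℂ (Module.End.eigenspace (T : B →ₗ[ℂ] B) 1) = 1 := by
  rw [hT.eigenspace_one, finrank_span_singleton hT.fixed_ne_zero]

theorem peripheralDim_eq_one [CompleteSpace B] (hT : HasSpectralGap T e ℓ) :
    peripheralDim T = 1 := by
  have h : (⨆ (z : ℂ) (_ : ENNReal.ofReal ‖z‖ = spectralRadius ℂ T),
      Module.End.maxGenEigenspace (T : B →ₗ[ℂ] B) z) = ℂ ∙ e := by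
    rw [hT.spectralRadius_eq_one]
    apply le_antisymm
    · refine iSup₂_le fun z hz => hT.maxGenEigenspace_le ?_
      rwa [ENNReal.ofReal_eq_one] at hz
    · refine le_iSup₂_of_le (1 : ℂ) (by simp) ?_
      rw [← hT.eigenspace_one]
      exact eigenspace_le_maxGenEigenspace T 1
  rw [peripheralDim, h, finrank_span_singleton hT.fixed_ne_zero]

end HasSpectralGap

end SpectralGap

/-! ### Weighted transfer operators on the projective space -/

section WeightedOperator

variable {d : ℕ} {μ : Measure (TopicalOperator d)}

/-- The weight `w` is dominated, uniformly in the projective variable, by `G`. -/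
def IsDominatedBy (μ : Measure (TopicalOperator d)) (w : StateSpace d → ℂ)
    (G : TopicalOperator d → ℝ) : Prop :=
  Integrable G μ ∧ ∀ᵐ B ∂μ, ∀ y, ‖w (B, y)‖ ≤ G B

theorem continuous_jMap_prodMk (y : ProjSpace d) :
    Continuous fun B : TopicalOperator d => jMap (B, y) :=
  continuous_jMap.comp (by fun_prop)

theorem IsDominatedBy.integrable {w : StateSpace d → ℂ} {G : TopicalOperator d → ℝ}
    (hG : IsDominatedBy μ w G) (hw : Continuous w) (ψ : ProjSpace d →ᵇ ℂ) (y : ProjSpace d) :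
    Integrable (fun B => w (B, y) * ψ (jMap (B, y))) μ := by
  refine Integrable.mono' (hG.1.mul_const ‖ψ‖) ?_ ?_
  · have h : Continuous fun B : TopicalOperator d => w (B, y) * ψ (jMap (B, y)) :=
      (hw.comp (by fun_prop)).mul (ψ.continuous.comp (continuous_jMap_prodMk y))
    exact h.aestronglyMeasurable
  · filter_upwards [hG.2] with B hB
    rw [norm_mul]
    exact mul_le_mul (hB y) (ψ.norm_coe_le_norm _) (norm_nonneg _) ((norm_nonneg _).trans (hB y))

theorem IsDominatedBy.norm_integral_le {w : StateSpace d → ℂ} {G : TopicalOperator d → ℝ}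
    (hG : IsDominatedBy μ w G) (ψ : ProjSpace d →ᵇ ℂ) (y : ProjSpace d) :
    ‖∫ B, w (B, y) * ψ (jMap (B, y)) ∂μ‖ ≤ (∫ B, G B ∂μ) * ‖ψ‖ := by
  rw [← integral_mul_const]
  refine norm_integral_le_of_norm_le (hG.1.mul_const ‖ψ‖) ?_
  filter_upwards [hG.2] with B hB
  rw [norm_mul]
  exact mul_le_mul (hB y) (ψ.norm_coe_le_norm _) (norm_nonneg _) ((norm_nonneg _).trans (hB y))

theorem IsDominatedBy.continuous_integral {w : StateSpace d → ℂ} {G : TopicalOperator d → ℝ}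
    (hG : IsDominatedBy μ w G) (hw : Continuous w) (ψ : ProjSpace d →ᵇ ℂ) :
    Continuous fun y => ∫ B, w (B, y) * ψ (jMap (B, y)) ∂μ := by
  refine continuous_of_dominated (bound := fun B => G B * ‖ψ‖)
    (fun y => (hG.integrable hw ψ y).aestronglyMeasurable) (fun y => ?_) (hG.1.mul_const _) ?_
  · filter_upwards [hG.2] with B hB
    rw [norm_mul]
    exact mul_le_mul (hB y) (ψ.norm_coe_le_norm _) (norm_nonneg _) ((norm_nonneg _).trans (hB y))
  · refine Filter.Eventually.of_forall fun B => ?_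
    exact (hw.comp (by fun_prop)).mul (ψ.continuous.comp (continuous_jMap.comp (by fun_prop)))

theorem IsDominatedBy.integral_nonneg [Nonempty (ProjSpace d)] {w : StateSpace d → ℂ}
    {G : TopicalOperator d → ℝ} (hG : IsDominatedBy μ w G) : 0 ≤ ∫ B, G B ∂μ := by
  refine integral_nonneg_of_ae ?_
  filter_upwards [hG.2] with B hB
  exact (norm_nonneg _).trans (hB (Classical.arbitrary _))

/-- The operator `ψ ↦ ∫ w (B, ·) ψ (B ·) μ(dB)`. -/
def weightedOperator (μ : Measure (TopicalOperator d)) (w : StateSpace d → ℂ) (hw : Continuous w)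
    (G : TopicalOperator d → ℝ) (hG : IsDominatedBy μ w G) :
    (ProjSpace d →ᵇ ℂ) →L[ℂ] (ProjSpace d →ᵇ ℂ) :=
  LinearMap.mkContinuous
    { toFun := fun ψ => BoundedContinuousFunction.ofNormedAddCommGroup
        (fun y => ∫ B, w (B, y) * ψ (jMap (B, y)) ∂μ) (hG.continuous_integral hw ψ)
        ((∫ B, G B ∂μ) * ‖ψ‖) (hG.norm_integral_le ψ)
      map_add' := fun ψ₁ ψ₂ => by
        ext y
        simp only [BoundedContinuousFunction.coe_ofNormedAddCommGroup,
          BoundedContinuousFunction.coe_add, Pi.add_apply, mul_add]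
        exact integral_add (hG.integrable hw ψ₁ y) (hG.integrable hw ψ₂ y)
      map_smul' := fun c ψ => by
        ext y
        simp only [BoundedContinuousFunction.coe_ofNormedAddCommGroup,
          BoundedContinuousFunction.coe_smul, smul_eq_mul, RingHom.id_apply]
        rw [← integral_const_mul]
        exact integral_congr_ae (Filter.Eventually.of_forall fun B => by ring) }
    -- The absolute value makes the bound visibly nonnegative; the bound without it is
    -- `opNorm_le_of_isDominatedBy`.
    |∫ B, G B ∂μ| fun ψ => by
      refine (BoundedContinuousFunction.norm_le (by positivity)).2 fun y => ?_
      exact (hG.norm_integral_le ψ y).trans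
        (mul_le_mul_of_nonneg_right (le_abs_self _) (norm_nonneg _))

theorem weightedOperator_apply {w : StateSpace d → ℂ} (hw : Continuous w)
    {G : TopicalOperator d → ℝ} (hG : IsDominatedBy μ w G) (ψ : ProjSpace d →ᵇ ℂ)
    (y : ProjSpace d) :
    weightedOperator μ w hw G hG ψ y = ∫ B, w (B, y) * ψ (jMap (B, y)) ∂μ := rfl

/-- An operator given by a dominated weight has norm at most the integral of the bound. -/
theorem opNorm_le_of_isDominatedBy {w : StateSpace d → ℂ} {G : TopicalOperator d → ℝ}
    (hG : IsDominatedBy μ w G) {S : (ProjSpace d →ᵇ ℂ) →L[ℂ] (ProjSpace d →ᵇ ℂ)}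
    (hS : ∀ ψ y, S ψ y = ∫ B, w (B, y) * ψ (jMap (B, y)) ∂μ) : ‖S‖ ≤ ∫ B, G B ∂μ := by
  have : Nonempty (ProjSpace d) := ⟨ProjSpace.mk 0⟩
  refine ContinuousLinearMap.opNorm_le_bound _ hG.integral_nonneg fun ψ => ?_
  refine (BoundedContinuousFunction.norm_le
    (mul_nonneg hG.integral_nonneg (norm_nonneg _))).2 fun y => ?_
  rw [hS]
  exact hG.norm_integral_le ψ y

end WeightedOperator

/-! ### The cocycle -/

section Cocycle

variable {d : ℕ}

/-- Isotony and homogeneity applied to `x ≤ y + dist x y` make `φ` non-expanding for the sup norm.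
-/
theorem IsTopicalFunction.continuous {φ : (Fin d → ℝ) → ℝ} (hφ : IsTopicalFunction φ) :
    Continuous φ := by
  have key : ∀ x y, φ x ≤ φ y + dist x y := by
    intro x y
    have h : x ≤ fun j => y j + dist x y := by
      intro j
      have h1 := dist_le_pi_dist x y j
      rw [Real.dist_eq] at h1
      have h2 := le_abs_self (x j - y j)
      show x j ≤ y j + dist x y
      linarith
    have h3 := hφ.isotone _ _ h
    rwa [hφ.homogeneous] at h3
  refine (LipschitzWith.of_dist_le_mul (K := 1) fun x y => ?_).continuous
  rw [NNReal.coe_one, one_mul, Real.dist_eq, abs_le]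
  have h1 := key x y
  have h2 := key y x
  rw [dist_comm y x] at h2
  constructor <;> linarith

theorem cocycle_mk (φ : (Fin d → ℝ) → ℝ) (hφ : IsTopicalFunction φ) (B : TopicalOperator d)
    (x : Fin d → ℝ) : cocycle φ hφ (B, ProjSpace.mk x) = φ (B x) - φ x := rfl

/-- Replaces the lift to the quotient by evaluation at a continuous representative, from which
continuity can be read off. -/
theorem cocycle_eq_repr (φ : (Fin d → ℝ) → ℝ) (hφ : IsTopicalFunction φ) (p : StateSpace d) :
    cocycle φ hφ p = φ (p.1 (ProjSpace.repr p.2)) - φ (ProjSpace.repr p.2) := by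
  rw [← cocycle_mk φ hφ, ProjSpace.mk_repr]

theorem continuous_cocycle (φ : (Fin d → ℝ) → ℝ) (hφ : IsTopicalFunction φ) :
    Continuous (cocycle φ hφ) := by
  rw [funext (cocycle_eq_repr φ hφ)]
  have h : Continuous fun p : StateSpace d => ProjSpace.repr p.2 :=
    ProjSpace.continuous_repr.comp continuous_snd
  exact (hφ.continuous.comp (TopicalOperator.continuous_eval.comp (continuous_fst.prodMk h))).sub
    (hφ.continuous.comp h)

/-- The supremum is uncountable, but a supremum of continuous functions is lower semicontinuous. -/
theorem measurable_supCocycle {φ : (Fin d → ℝ) → ℝ} (hφ : IsTopicalFunction φ) :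
    Measurable (supCocycle φ : TopicalOperator d → ℝ≥0∞) := by
  refine LowerSemicontinuous.measurable (lowerSemicontinuous_iSup fun x => ?_)
  refine Continuous.lowerSemicontinuous ?_
  have h : Continuous fun B : TopicalOperator d => B x :=
    TopicalOperator.continuous_eval.comp (continuous_id.prodMk continuous_const)
  exact ENNReal.continuous_ofReal.comp ((hφ.continuous.comp h).sub continuous_const).abs

theorem abs_cocycle_le (φ : (Fin d → ℝ) → ℝ) (hφ : IsTopicalFunction φ) {B : TopicalOperator d}
    (hB : supCocycle φ B < ∞) (y : ProjSpace d) :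
    |cocycle φ hφ (B, y)| ≤ (supCocycle φ B).toReal := by
  rw [cocycle_eq_repr]
  rw [← ENNReal.ofReal_le_iff_le_toReal hB.ne]
  exact le_iSup (fun x => ENNReal.ofReal |φ (B x) - φ x|) _

end Cocycle

/-- Taylor's bound for `|u| ≤ 1`, the triangle inequality otherwise. The factor `min 1 |u|` is
bounded and tends to `0`: after integration it yields an `o(h)` remainder with no additional moment.
-/
theorem norm_exp_mul_I_sub_one_sub_le (u : ℝ) :
    ‖Complex.exp (Complex.I * u) - 1 - Complex.I * u‖ ≤ |u| * (2 * min 1 |u|) := by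
  rcases le_total |u| 1 with h | h
  · rw [min_eq_right h]
    have h1 : ‖Complex.I * (u : ℂ)‖ = |u| := by simp
    have h2 := Complex.norm_exp_sub_one_sub_id_le (h1.le.trans h)
    rw [h1] at h2
    nlinarith [abs_nonneg u]
  · rw [min_eq_left h]
    have h1 : ‖Complex.I * (u : ℂ)‖ = |u| := by simp
    have h2 := norm_sub_le (Complex.exp (Complex.I * u) - 1) (Complex.I * u)
    have h3 := Real.norm_exp_I_mul_ofReal_sub_one_le (x := u)
    rw [Real.norm_eq_abs] at h3
    linarith

theorem norm_exp_mul_I_sub_one_le (u : ℝ) :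
    ‖Complex.exp (Complex.I * u) - 1‖ ≤ 2 * min 1 |u| := by
  rcases le_total |u| 1 with h | h
  · rw [min_eq_right h]
    have h3 := Real.norm_exp_I_mul_ofReal_sub_one_le (x := u)
    rw [Real.norm_eq_abs] at h3
    linarith [abs_nonneg u]
  · rw [min_eq_left h]
    refine (norm_sub_le _ _).trans ?_
    rw [mul_comm, Complex.norm_exp_ofReal_mul_I, norm_one]
    norm_num

/-! ### Regularity of the Fourier operators -/

/-- A family of functions in which each one is the derivative of the previous one, with explicit
moduli of continuity and differentiability. -/
theorem contDiff_of_modulus {F : Type*} [NormedAddCommGroup F] [NormedSpace ℝ F] {m : ℕ}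
    {f : ℕ → ℝ → F} (w : ℕ → ℝ → ℝ) (hw0 : ∀ k h, 0 ≤ w k h)
    (hw : ∀ k ≤ m, ∀ t, Filter.Tendsto (fun s => w k (s - t)) (nhds t) (nhds 0))
    (hf : ∀ k ≤ m, ∀ s t, ‖f k s - f k t‖ ≤ w k (s - t))
    (hf' : ∀ k, k + 1 ≤ m → ∀ s t,
      ‖f k s - f k t - (s - t) • f (k + 1) t‖ ≤ |s - t| * w (k + 1) (s - t))
    (n k : ℕ) (hk : k + n ≤ m) : ContDiff ℝ (n : WithTop ℕ∞) (f k) := by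
  induction n generalizing k with
  | zero =>
    refine contDiff_zero.2 (continuous_iff_continuousAt.2 fun t =>
      tendsto_iff_norm_sub_tendsto_zero.2 ?_)
    exact squeeze_zero (fun s => norm_nonneg _) (fun s => hf k hk s t) (hw k hk t)
  | succ n ih =>
    have hd : ∀ t, HasDerivAt (f k) (f (k + 1) t) t := by
      intro t
      refine hasDerivAt_iff_tendsto.2 (squeeze_zero (fun s => by positivity) (fun s => ?_)
        (hw (k + 1) (by omega) t))
      -- At `s = t` the difference quotient is `0` by convention, and only the nonnegativity of the
      -- modulus is needed.
      rcases eq_or_ne s t with rfl | hst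
      · simpa using hw0 (k + 1) 0
      · rw [Real.norm_eq_abs, inv_mul_le_iff₀ (abs_pos.2 (sub_ne_zero.2 hst))]
        exact hf' k (by omega) s t
    rw [Nat.cast_succ, contDiff_succ_iff_deriv]
    refine ⟨fun t => (hd t).differentiableAt, fun h => absurd h (by simp), ?_⟩
    rw [show deriv (f k) = f (k + 1) from funext fun t => (hd t).deriv]
    exact ih (k + 1) (by omega)

section Fourier

variable {d : ℕ} (μ : Measure (TopicalOperator d)) (φ : (Fin d → ℝ) → ℝ)
  (hφ : IsTopicalFunction φ)

/-- The weight `(iξ)^k e^{itξ}`. -/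
def fourierWeight (k : ℕ) (t : ℝ) (p : StateSpace d) : ℂ :=
  (Complex.I * cocycle φ hφ p) ^ k * Complex.exp (Complex.I * t * cocycle φ hφ p)

theorem continuous_fourierWeight (k : ℕ) (t : ℝ) : Continuous (fourierWeight φ hφ k t) := by
  have h := continuous_cocycle φ hφ
  unfold fourierWeight
  fun_prop

theorem norm_exp_I_mul_mul (t u : ℝ) : ‖Complex.exp (Complex.I * t * u)‖ = 1 := by
  have h : Complex.I * t * u = ((t * u : ℝ) : ℂ) * Complex.I := by push_cast; ring
  rw [h, Complex.norm_exp_ofReal_mul_I]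

theorem norm_fourierWeight (k : ℕ) (t : ℝ) (p : StateSpace d) :
    ‖fourierWeight φ hφ k t p‖ = |cocycle φ hφ p| ^ k := by
  rw [fourierWeight, norm_mul, norm_exp_I_mul_mul, mul_one, norm_pow, norm_mul, Complex.norm_I,
    one_mul, Complex.norm_real, Real.norm_eq_abs]

theorem exp_I_mul_split (s t u : ℝ) : Complex.exp (Complex.I * s * u) =
    Complex.exp (Complex.I * t * u) * Complex.exp (Complex.I * ((s - t) * u : ℝ)) := by
  rw [← Complex.exp_add]
  congr 1
  push_cast
  ring

/-- The weight at `t` factors out and leaves `e^{i(s-t)ξ} - 1`. The bound is increasing in `|ξ|`, so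
`ξ` can be replaced by a bound free of the projective variable. -/
theorem norm_fourierWeight_sub_le (k : ℕ) (s t : ℝ) (p : StateSpace d) {a : ℝ}
    (ha : |cocycle φ hφ p| ≤ a) :
    ‖fourierWeight φ hφ k s p - fourierWeight φ hφ k t p‖ ≤
      a ^ k * (2 * min 1 (|s - t| * a)) := by
  have h : fourierWeight φ hφ k s p - fourierWeight φ hφ k t p = fourierWeight φ hφ k t p *
      (Complex.exp (Complex.I * ((s - t) * cocycle φ hφ p : ℝ)) - 1) := by
    rw [fourierWeight, fourierWeight, exp_I_mul_split s t]
    ring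
  rw [h, norm_mul, norm_fourierWeight]
  have h1 := norm_exp_mul_I_sub_one_le ((s - t) * cocycle φ hφ p)
  rw [abs_mul] at h1
  have h2 : 2 * min 1 (|s - t| * |cocycle φ hφ p|) ≤ 2 * min 1 (|s - t| * a) := by gcongr
  have ha0 : 0 ≤ a := (abs_nonneg _).trans ha
  exact mul_le_mul (pow_le_pow_left₀ (abs_nonneg _) ha k) (h1.trans h2) (norm_nonneg _)
    (by positivity)

/-- The weight of order `k + 1` is `iξ` times that of order `k`, so factoring leaves the first order
Taylor remainder of the exponential. -/
theorem norm_fourierWeight_sub_sub_le (k : ℕ) (s t : ℝ) (p : StateSpace d) {a : ℝ}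
    (ha : |cocycle φ hφ p| ≤ a) :
    ‖fourierWeight φ hφ k s p - fourierWeight φ hφ k t p -
        (s - t : ℝ) * fourierWeight φ hφ (k + 1) t p‖ ≤
      |s - t| * (a ^ (k + 1) * (2 * min 1 (|s - t| * a))) := by
  have h : fourierWeight φ hφ k s p - fourierWeight φ hφ k t p -
        (s - t : ℝ) * fourierWeight φ hφ (k + 1) t p = fourierWeight φ hφ k t p *
      (Complex.exp (Complex.I * ((s - t) * cocycle φ hφ p : ℝ)) - 1 -
        Complex.I * ((s - t) * cocycle φ hφ p : ℝ)) := by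
    rw [fourierWeight, fourierWeight, fourierWeight, exp_I_mul_split s t]
    push_cast
    ring
  rw [h, norm_mul, norm_fourierWeight]
  have ha0 : 0 ≤ a := (abs_nonneg _).trans ha
  have h1 := norm_exp_mul_I_sub_one_sub_le ((s - t) * cocycle φ hφ p)
  rw [abs_mul] at h1
  have h2 : |s - t| * |cocycle φ hφ p| * (2 * min 1 (|s - t| * |cocycle φ hφ p|)) ≤
      |s - t| * a * (2 * min 1 (|s - t| * a)) := by gcongr
  calc _ ≤ a ^ k * (|s - t| * a * (2 * min 1 (|s - t| * a))) :=
        mul_le_mul (pow_le_pow_left₀ (abs_nonneg _) ha k) (h1.trans h2) (norm_nonneg _)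
          (by positivity)
    _ = _ := by ring

/-- The supremum of the cocycle as a real number. -/
def supCocycleReal (φ : (Fin d → ℝ) → ℝ) (B : TopicalOperator d) : ℝ := (supCocycle φ B).toReal

theorem supCocycleReal_nonneg (B : TopicalOperator d) : 0 ≤ supCocycleReal φ B :=
  ENNReal.toReal_nonneg

theorem measurable_supCocycleReal (hφ : IsTopicalFunction φ) :
    Measurable (supCocycleReal φ : TopicalOperator d → ℝ) :=
  (measurable_supCocycle hφ).ennreal_toReal

variable {μ} {φ} {m : ℕ}

theorem HasMoment.integrable_pow [IsFiniteMeasure μ] (hm : HasMoment μ (supCocycle φ) m)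
    (hφ : IsTopicalFunction φ) {k : ℕ} (hk : k ≤ m) : Integrable (fun B => supCocycleReal φ B ^ k) μ := by
  have h1 : Integrable (fun B => supCocycleReal φ B ^ m) μ := by
    have := integrable_toReal_of_lintegral_ne_top (f := fun B => supCocycle φ B ^ m)
      ((measurable_supCocycle hφ).pow_const m).aemeasurable hm.2.ne
    simpa only [supCocycleReal, ← ENNReal.toReal_pow] using this
  -- The dominating function comes from `σ^k ≤ 1 + σ^m`.
  refine Integrable.mono' ((integrable_const (1 : ℝ)).add h1)
    ((measurable_supCocycleReal φ hφ).pow_const k).aestronglyMeasurable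
    (Filter.Eventually.of_forall fun B => ?_)
  have h0 := supCocycleReal_nonneg φ B
  rw [Real.norm_of_nonneg (pow_nonneg h0 k), Pi.add_apply]
  rcases le_total (supCocycleReal φ B) 1 with h | h
  · have := pow_le_one₀ (n := k) h0 h
    have := pow_nonneg h0 m
    linarith
  · have := pow_le_pow_right₀ h hk
    linarith

/-- `supCocycleReal` takes the default value `0` where `σ = ∞`, so almost sure finiteness is
essential; for `m = 0` the moment bound does not imply it. -/
theorem HasMoment.ae_abs_cocycle_le (hm : HasMoment μ (supCocycle φ) m) :
    ∀ᵐ B ∂μ, ∀ y, |cocycle φ hφ (B, y)| ≤ supCocycleReal φ B := by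
  filter_upwards [hm.1] with B hB y
  exact abs_cocycle_le φ hφ hB y

theorem HasMoment.isDominatedBy_fourierWeight [IsFiniteMeasure μ]
    (hm : HasMoment μ (supCocycle φ) m) {k : ℕ} (hk : k ≤ m) (t : ℝ) :
    IsDominatedBy μ (fourierWeight φ hφ k t) (fun B => supCocycleReal φ B ^ k) := by
  refine ⟨hm.integrable_pow hφ hk, ?_⟩
  filter_upwards [hm.ae_abs_cocycle_le hφ] with B hB y
  rw [norm_fourierWeight]
  exact pow_le_pow_left₀ (abs_nonneg _) (hB y) k

/-- The operator with weight `(iξ)^k e^{itξ}` (and `0` if there is no moment of order `k`). -/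
def fourierOperator [IsFiniteMeasure μ] (hm : HasMoment μ (supCocycle φ) m) (k : ℕ) (t : ℝ) :
    (ProjSpace d →ᵇ ℂ) →L[ℂ] (ProjSpace d →ᵇ ℂ) :=
  if hk : k ≤ m then
    weightedOperator μ (fourierWeight φ hφ k t) (continuous_fourierWeight φ hφ k t) _
      (hm.isDominatedBy_fourierWeight hφ hk t)
  else 0

theorem fourierOperator_apply [IsFiniteMeasure μ] (hm : HasMoment μ (supCocycle φ) m) {k : ℕ}
    (hk : k ≤ m) (t : ℝ) (ψ : ProjSpace d →ᵇ ℂ) (y : ProjSpace d) :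
    fourierOperator hφ hm k t ψ y =
      ∫ B, fourierWeight φ hφ k t (B, y) * ψ (jMap (B, y)) ∂μ := by
  rw [fourierOperator, dif_pos hk]
  rfl

theorem HasMoment.integrable_fourierWeight_mul [IsFiniteMeasure μ]
    (hm : HasMoment μ (supCocycle φ) m) {k : ℕ} (hk : k ≤ m) (t : ℝ) (ψ : ProjSpace d →ᵇ ℂ)
    (y : ProjSpace d) :
    Integrable (fun B => fourierWeight φ hφ k t (B, y) * ψ (jMap (B, y))) μ :=
  (hm.isDominatedBy_fourierWeight hφ hk t).integrable (continuous_fourierWeight φ hφ k t) ψ y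

/-- The modulus of continuity of the Fourier operators. -/
def fourierModulus (μ : Measure (TopicalOperator d)) (φ : (Fin d → ℝ) → ℝ) (k : ℕ) (h : ℝ) : ℝ :=
  ∫ B, supCocycleReal φ B ^ k * (2 * min 1 (|h| * supCocycleReal φ B)) ∂μ

theorem norm_modulus_integrand_le (k : ℕ) (h : ℝ) (B : TopicalOperator d) :
    ‖supCocycleReal φ B ^ k * (2 * min 1 (|h| * supCocycleReal φ B))‖ ≤
      supCocycleReal φ B ^ k * 2 := by
  have h0 := supCocycleReal_nonneg φ B
  have h1 : 0 ≤ min 1 (|h| * supCocycleReal φ B) := le_min zero_le_one (by positivity)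
  have h2 : min 1 (|h| * supCocycleReal φ B) ≤ 1 := min_le_left _ _
  rw [Real.norm_of_nonneg (by positivity)]
  gcongr
  linarith

theorem measurable_modulus_integrand (hφ : IsTopicalFunction φ) (k : ℕ) (h : ℝ) :
    Measurable fun B : TopicalOperator d =>
      supCocycleReal φ B ^ k * (2 * min 1 (|h| * supCocycleReal φ B)) := by
  have := measurable_supCocycleReal φ hφ
  fun_prop

theorem HasMoment.integrable_modulus_integrand [IsFiniteMeasure μ]
    (hm : HasMoment μ (supCocycle φ) m) (hφ : IsTopicalFunction φ) {k : ℕ} (hk : k ≤ m) (h : ℝ) :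
    Integrable (fun B => supCocycleReal φ B ^ k * (2 * min 1 (|h| * supCocycleReal φ B))) μ :=
  Integrable.mono' ((hm.integrable_pow hφ hk).mul_const 2)
    (measurable_modulus_integrand hφ k h).aestronglyMeasurable
    (Filter.Eventually.of_forall (norm_modulus_integrand_le k h))

/-- Dominated convergence: the integrand tends to `0` pointwise and stays below `2 σ^k`. -/
theorem HasMoment.tendsto_fourierModulus [IsFiniteMeasure μ]
    (hm : HasMoment μ (supCocycle φ) m) (hφ : IsTopicalFunction φ) {k : ℕ} (hk : k ≤ m) (t : ℝ) :
    Filter.Tendsto (fun s => fourierModulus μ φ k (s - t)) (nhds t) (nhds 0) := by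
  have h : Filter.Tendsto (fun s => fourierModulus μ φ k (s - t)) (nhds t)
      (nhds (∫ _B : TopicalOperator d, (0 : ℝ) ∂μ)) := by
    refine tendsto_integral_filter_of_dominated_convergence _
      (Filter.Eventually.of_forall fun s =>
        (measurable_modulus_integrand hφ k (s - t)).aestronglyMeasurable)
      (Filter.Eventually.of_forall fun s =>
        Filter.Eventually.of_forall (norm_modulus_integrand_le k (s - t)))
      ((hm.integrable_pow hφ hk).mul_const 2) (Filter.Eventually.of_forall fun B => ?_)
    have hc : Continuous fun s =>
        supCocycleReal φ B ^ k * (2 * min 1 (|s - t| * supCocycleReal φ B)) := by fun_prop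
    simpa using hc.tendsto t
  simpa using h

theorem norm_fourierOperator_sub_le [IsFiniteMeasure μ] (hm : HasMoment μ (supCocycle φ) m)
    {k : ℕ} (hk : k ≤ m) (s t : ℝ) :
    ‖fourierOperator hφ hm k s - fourierOperator hφ hm k t‖ ≤ fourierModulus μ φ k (s - t) := by
  refine opNorm_le_of_isDominatedBy
    (w := fun p => fourierWeight φ hφ k s p - fourierWeight φ hφ k t p)
    ⟨hm.integrable_modulus_integrand hφ hk _, ?_⟩ fun ψ y => ?_
  · filter_upwards [hm.ae_abs_cocycle_le hφ] with B hB y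
    exact norm_fourierWeight_sub_le φ hφ k s t (B, y) (hB y)
  · rw [sub_apply, BoundedContinuousFunction.sub_apply,
      fourierOperator_apply hφ hm hk, fourierOperator_apply hφ hm hk, ← integral_sub
        (hm.integrable_fourierWeight_mul hφ hk s ψ y) (hm.integrable_fourierWeight_mul hφ hk t ψ y)]
    exact integral_congr_ae (Filter.Eventually.of_forall fun B => by ring)

theorem norm_fourierOperator_sub_sub_le [IsFiniteMeasure μ] (hm : HasMoment μ (supCocycle φ) m)
    {k : ℕ} (hk : k + 1 ≤ m) (s t : ℝ) :
    ‖fourierOperator hφ hm k s - fourierOperator hφ hm k t -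
        (s - t) • fourierOperator hφ hm (k + 1) t‖ ≤
      |s - t| * fourierModulus μ φ (k + 1) (s - t) := by
  rw [fourierModulus, ← integral_const_mul]
  refine opNorm_le_of_isDominatedBy
    (w := fun p => fourierWeight φ hφ k s p - fourierWeight φ hφ k t p -
      (s - t : ℝ) * fourierWeight φ hφ (k + 1) t p)
    ⟨(hm.integrable_modulus_integrand hφ hk _).const_mul _, ?_⟩ fun ψ y => ?_
  · filter_upwards [hm.ae_abs_cocycle_le hφ] with B hB y
    exact norm_fourierWeight_sub_sub_le φ hφ k s t (B, y) (hB y)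
  · have hk' : k ≤ m := by omega
    have i1 := hm.integrable_fourierWeight_mul hφ hk' s ψ y
    have i2 := hm.integrable_fourierWeight_mul hφ hk' t ψ y
    have i3 := (hm.integrable_fourierWeight_mul hφ hk t ψ y).const_mul ((s - t : ℝ) : ℂ)
    rw [sub_apply, BoundedContinuousFunction.sub_apply,
      sub_apply, BoundedContinuousFunction.sub_apply,
      smul_apply, BoundedContinuousFunction.smul_apply, Complex.real_smul,
      fourierOperator_apply hφ hm hk', fourierOperator_apply hφ hm hk',
      fourierOperator_apply hφ hm hk, ← integral_const_mul, ← integral_sub i1 i2]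
    refine (integral_sub (i1.sub i2) i3).symm.trans ?_
    exact integral_congr_ae (Filter.Eventually.of_forall fun B => by
      simp only [Pi.sub_apply]; ring)

theorem fourierModulus_nonneg (k : ℕ) (h : ℝ) : 0 ≤ fourierModulus μ φ k h :=
  integral_nonneg fun B => by
    have h0 := supCocycleReal_nonneg φ B
    have h1 : 0 ≤ min 1 (|h| * supCocycleReal φ B) := le_min zero_le_one (by positivity)
    simp only [Pi.zero_apply]
    positivity

theorem contDiff_fourierOperator [IsFiniteMeasure μ] (hm : HasMoment μ (supCocycle φ) m) :
    ContDiff ℝ (m : WithTop ℕ∞) (fourierOperator hφ hm 0) :=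
  contDiff_of_modulus (fourierModulus μ φ) fourierModulus_nonneg
    (fun _ hk t => hm.tendsto_fourierModulus hφ hk t)
    (fun _ hk s t => norm_fourierOperator_sub_le hφ hm hk s t)
    (fun _ hk s t => norm_fourierOperator_sub_sub_le hφ hm hk s t) m 0 (by omega)

end Fourier

/-! ### Action of measures and stationary measures -/

section Action

variable {d : ℕ}

theorem continuous_comp :
    Continuous fun p : TopicalOperator d × TopicalOperator d => p.1.comp p.2 := by
  rw [TopicalOperator.isInducing_toContinuousMap.continuous_iff]
  have h := TopicalOperator.isInducing_toContinuousMap (d := d).continuous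
  exact (h.comp continuous_fst).compCM (h.comp continuous_snd)

theorem measurable_productUpTo {Ω : Type*} [MeasurableSpace Ω] {A : ℕ → Ω → TopicalOperator d}
    (hA : ∀ n, Measurable (A n)) (n : ℕ) :
    Measurable fun ω => productUpTo (fun k => A k ω) n := by
  induction n with
  | zero => exact measurable_const
  | succ n ih => exact continuous_comp.measurable.comp ((hA (n + 1)).prodMk ih)

theorem productUpTo_congr {A A' : ℕ → TopicalOperator d} (n : ℕ) (h : ∀ k ≤ n, A k = A' k) :
    productUpTo A n = productUpTo A' n := by
  induction n with
  | zero => rfl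
  | succ n ih =>
    rw [productUpTo, productUpTo, h (n + 1) le_rfl, ih fun k hk => h k (by omega)]

/-- An uncountable intersection, but of closed sets. -/
theorem measurableSet_isRankOne : MeasurableSet {M : TopicalOperator d | M.IsRankOne} := by
  have h : {M : TopicalOperator d | M.IsRankOne} = ⋂ x : Fin d → ℝ, ⋂ y : Fin d → ℝ,
      {M : TopicalOperator d | ProjSpace.mk (M x) = ProjSpace.mk (M y)} := by
    ext M
    simp [TopicalOperator.IsRankOne]
  rw [h]
  have hc : ∀ x : Fin d → ℝ, Continuous fun M : TopicalOperator d => ProjSpace.mk (M x) :=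
    fun x => ProjSpace.continuous_mk.comp
      (TopicalOperator.continuous_eval.comp (continuous_id.prodMk continuous_const))
  exact (isClosed_iInter fun x => isClosed_iInter fun y =>
    isClosed_eq (hc x) (hc y)).measurableSet

theorem TopicalOperator.IsRankOne.jMap_eq {M : TopicalOperator d} (hM : M.IsRankOne)
    (y y' : ProjSpace d) : jMap (M, y) = jMap (M, y') :=
  Quotient.inductionOn₂ y y' fun x x' => hM x x'

theorem jMap_comp (M M' : TopicalOperator d) (y : ProjSpace d) :
    jMap (M.comp M', y) = jMap (M, jMap (M', y)) :=
  Quotient.inductionOn y fun _ => rfl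

theorem jMap_id (y : ProjSpace d) : jMap (TopicalOperator.id d, y) = y :=
  Quotient.inductionOn y fun _ => rfl

/-- The image of `μ ⊗ ρ` by the action of the topical operators on the projective space. -/
def act (μ : Measure (TopicalOperator d)) (ρ : Measure (ProjSpace d)) : Measure (ProjSpace d) :=
  (μ.prod ρ).map jMap

theorem act_apply_univ (μ : Measure (TopicalOperator d)) [SFinite μ] (ρ : Measure (ProjSpace d))
    [SFinite ρ] : act μ ρ Set.univ = μ Set.univ * ρ Set.univ := by
  rw [act, Measure.map_apply continuous_jMap.measurable MeasurableSet.univ, Set.preimage_univ,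
    ← Set.univ_prod_univ, Measure.prod_prod]

instance (μ : Measure (TopicalOperator d)) [IsFiniteMeasure μ] (ρ : Measure (ProjSpace d))
    [IsFiniteMeasure ρ] : IsFiniteMeasure (act μ ρ) :=
  inferInstanceAs (IsFiniteMeasure ((μ.prod ρ).map jMap))

theorem add_act (μ μ' : Measure (TopicalOperator d)) [SFinite μ] [SFinite μ']
    (ρ : Measure (ProjSpace d)) [SFinite ρ] : act (μ + μ') ρ = act μ ρ + act μ' ρ := by
  rw [act, Measure.add_prod, Measure.map_add _ _ continuous_jMap.measurable]
  rfl

theorem act_sum (μ : Measure (TopicalOperator d)) (ρ : ℕ → Measure (ProjSpace d))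
    [∀ n, SFinite (ρ n)] : act μ (Measure.sum ρ) = Measure.sum fun n => act μ (ρ n) := by
  rw [act, Measure.prod_sum_right, Measure.map_sum continuous_jMap.measurable.aemeasurable]
  rfl

theorem act_apply (μ : Measure (TopicalOperator d)) [SFinite μ] (ρ : Measure (ProjSpace d))
    [SFinite ρ] {s : Set (ProjSpace d)} (hs : MeasurableSet s) :
    act μ ρ s = ∫⁻ y, μ {B | jMap (B, y) ∈ s} ∂ρ := by
  rw [act, Measure.map_apply continuous_jMap.measurable hs,
    Measure.prod_apply_symm (continuous_jMap.measurable hs)]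
  rfl

theorem act_finset_sum (μ : Measure (TopicalOperator d)) [SFinite μ]
    (ρ : ℕ → Measure (ProjSpace d)) [∀ n, IsFiniteMeasure (ρ n)] (n : ℕ) :
    act μ (∑ j ∈ Finset.range n, ρ j) = ∑ j ∈ Finset.range n, act μ (ρ j) := by
  ext s hs
  rw [act_apply _ _ hs, lintegral_finsetSum_measure, Measure.finsetSum_apply]
  exact Finset.sum_congr rfl fun j _ => (act_apply _ _ hs).symm

theorem act_smul (μ : Measure (TopicalOperator d)) [SFinite μ] (c : ℝ≥0∞)
    (ρ : Measure (ProjSpace d)) [SFinite ρ] : act μ (c • ρ) = c • act μ ρ := by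
  ext s hs
  rw [act_apply _ _ hs, lintegral_smul_measure, Measure.smul_apply, act_apply _ _ hs]

/-- The laws supported on rank one operators forget the initial point. -/
theorem act_eq_of_ae_isRankOne (μ : Measure (TopicalOperator d)) [SFinite μ]
    (hμ : ∀ᵐ M ∂μ, M.IsRankOne) (ρ : Measure (ProjSpace d)) [IsProbabilityMeasure ρ]
    (y₀ : ProjSpace d) : act μ ρ = act μ (Measure.dirac y₀) := by
  have key : ∀ (y : ProjSpace d) (s : Set (ProjSpace d)), μ {B | jMap (B, y) ∈ s} =
      μ {B | jMap (B, y₀) ∈ s} := fun y s => by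
    refine measure_congr ?_
    filter_upwards [hμ] with M hM
    exact congrArg (· ∈ s) (hM.jMap_eq y y₀)
  ext s hs
  rw [act_apply _ _ hs, act_apply _ _ hs, lintegral_congr fun y => key y s,
    lintegral_congr (μ := Measure.dirac y₀) fun y => key y s]
  simp

/-- Split `μ` into its restrictions to `R` and `Rᶜ`. For every probability `π`, the first part sends
`π` to the same measure as a Dirac mass at `y₀`, so stationarity reads `π = act μ_R δ + act μ_{Rᶜ}
π`. The solution is the Neumann series of terms `ρ n`, whose masses form a geometric series of sum
`1`. -/
theorem exists_act_eq_self_of_isRankOne (μ : Measure (TopicalOperator d)) [IsProbabilityMeasure μ]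
    (hμ : 0 < μ {M | M.IsRankOne}) :
    ∃ π : Measure (ProjSpace d), IsProbabilityMeasure π ∧ act μ π = π := by
  set R : Set (TopicalOperator d) := {M | M.IsRankOne}
  have hR : MeasurableSet R := measurableSet_isRankOne
  let y₀ : ProjSpace d := ProjSpace.mk 0
  let ρ : ℕ → Measure (ProjSpace d) := fun n =>
    (act (μ.restrict Rᶜ))^[n] (act (μ.restrict R) (Measure.dirac y₀))
  have hsucc : ∀ n, ρ (n + 1) = act (μ.restrict Rᶜ) (ρ n) := fun n =>
    Function.iterate_succ_apply' _ _ _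
  have hfin : ∀ n, IsFiniteMeasure (ρ n) := by
    intro n
    induction n with
    | zero => exact inferInstanceAs (IsFiniteMeasure (act (μ.restrict R) (Measure.dirac y₀)))
    | succ n ih => rw [hsucc]; infer_instance
  have hmass : ∀ n, ρ n Set.univ = μ Rᶜ ^ n * μ R := by
    intro n
    induction n with
    | zero =>
      rw [pow_zero, one_mul]
      show act (μ.restrict R) (Measure.dirac y₀) Set.univ = μ R
      rw [act_apply_univ]
      simp
    | succ n ih => rw [hsucc, act_apply_univ, ih, Measure.restrict_apply_univ, pow_succ']; ring
  have hprob : IsProbabilityMeasure (Measure.sum ρ) := ⟨by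
    rw [Measure.sum_apply _ MeasurableSet.univ, tsum_congr hmass, ENNReal.tsum_mul_right,
      ENNReal.tsum_geometric, prob_compl_eq_one_sub hR,
      ENNReal.sub_sub_cancel ENNReal.one_ne_top prob_le_one,
      ENNReal.inv_mul_cancel hμ.ne' (measure_ne_top _ _)]⟩
  refine ⟨Measure.sum ρ, hprob, ?_⟩
  conv_lhs => rw [← Measure.restrict_add_restrict_compl (μ := μ) hR]
  -- The rank one part produces the term `ρ 0`, the other part shifts the series by one.
  rw [add_act, act_eq_of_ae_isRankOne (μ.restrict R) (ae_restrict_mem hR) _ y₀, act_sum]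
  ext s hs
  rw [Measure.add_apply, Measure.sum_apply _ hs, Measure.sum_apply _ hs,
    tsum_eq_zero_add' (f := fun i => ρ i s) ENNReal.summable]
  simp only [hsucc]
  rfl

end Action

/-! ### Products of independent operators -/

section Product

variable {Ω : Type*} [MeasurableSpace Ω] {P : Measure Ω} {d : ℕ} {A : ℕ → Ω → TopicalOperator d}

/-- The law of `A n ⋯ A 1`. -/
def productLaw (P : Measure Ω) (A : ℕ → Ω → TopicalOperator d) (n : ℕ) :
    Measure (TopicalOperator d) := P.map fun ω => productUpTo (fun k => A k ω) n

theorem isProbabilityMeasure_productLaw [IsProbabilityMeasure P] (hA : ∀ n, Measurable (A n))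
    (n : ℕ) : IsProbabilityMeasure (productLaw P A n) :=
  Measure.isProbabilityMeasure_map (measurable_productUpTo hA n).aemeasurable

theorem productLaw_zero [IsProbabilityMeasure P] :
    productLaw P A 0 = Measure.dirac (TopicalOperator.id d) := by
  show P.map (fun _ => TopicalOperator.id d) = _
  rw [Measure.map_const, measure_univ, one_smul]

theorem indepFun_productUpTo (hA : ∀ n, Measurable (A n)) (hindep : iIndepFun A P) (n : ℕ) :
    IndepFun (A (n + 1)) (fun ω => productUpTo (fun k => A k ω) n) P := by
  have h := hindep.indepFun_finset {n + 1} (Finset.range (n + 1)) (by simp) hA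
  -- Indices outside the range are filled with the identity so that `F` can use `productUpTo`; they
  -- do not enter the product, and neither does the index `0`.
  let F : (Finset.range (n + 1) → TopicalOperator d) → TopicalOperator d := fun t =>
    productUpTo (fun k => if hk : k ∈ Finset.range (n + 1) then t ⟨k, hk⟩
      else TopicalOperator.id d) n
  have hF : Measurable F := by
    refine measurable_productUpTo (fun k => ?_) n
    by_cases hk : k ∈ Finset.range (n + 1)
    · simp only [hk, dif_pos]
      exact measurable_pi_apply _
    · simp only [hk, dif_neg, not_false_eq_true]
      exact measurable_const
  have h' := h.comp (measurable_pi_apply (⟨n + 1, by simp⟩ : ({n + 1} : Finset ℕ))) hF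
  refine h'.congr (Filter.EventuallyEq.rfl) (Filter.Eventually.of_forall fun ω => ?_)
  refine productUpTo_congr n fun k hk => ?_
  rw [dif_pos (Finset.mem_range.2 (by omega))]

theorem productLaw_succ [IsProbabilityMeasure P] (hA : ∀ n, Measurable (A n))
    (hindep : iIndepFun A P) (hident : ∀ n, IdentDistrib (A n) (A 1) P P) (n : ℕ) :
    productLaw P A (n + 1) = ((P.map (A 1)).prod (productLaw P A n)).map
      fun p => p.1.comp p.2 := by
  have h := (indepFun_iff_map_prod_eq_prod_map_map (hA (n + 1)).aemeasurable
    (measurable_productUpTo hA n).aemeasurable).1 (indepFun_productUpTo hA hindep n)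
  rw [(hident (n + 1)).map_eq] at h
  rw [productLaw, productLaw, ← h, Measure.map_map continuous_comp.measurable
    ((hA (n + 1)).prodMk (measurable_productUpTo hA n))]
  rfl

theorem act_productLaw_zero [IsProbabilityMeasure P] (ρ : Measure (ProjSpace d)) [SFinite ρ] :
    act (productLaw P A 0) ρ = ρ := by
  rw [productLaw_zero, act, Measure.dirac_prod,
    Measure.map_map continuous_jMap.measurable measurable_prodMk_left]
  have h : jMap ∘ Prod.mk (TopicalOperator.id d) = id := funext jMap_id
  rw [h, Measure.map_id]

theorem act_productLaw_succ [IsProbabilityMeasure P] (hA : ∀ n, Measurable (A n))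
    (hindep : iIndepFun A P) (hident : ∀ n, IdentDistrib (A n) (A 1) P P) (n : ℕ)
    (ρ : Measure (ProjSpace d)) [IsFiniteMeasure ρ] :
    act (productLaw P A (n + 1)) ρ = act (P.map (A 1)) (act (productLaw P A n) ρ) := by
  have := isProbabilityMeasure_productLaw (P := P) hA n
  have := isProbabilityMeasure_productLaw (P := P) hA (n + 1)
  have : IsProbabilityMeasure (P.map (A 1)) := Measure.isProbabilityMeasure_map (hA 1).aemeasurable
  ext s hs
  have hmeas : MeasurableSet (jMap ⁻¹' s : Set (StateSpace d)) := continuous_jMap.measurable hs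
  have hmeas_slice : Measurable fun y => P.map (A 1) {B | jMap (B, y) ∈ s} :=
    measurable_measure_prodMk_right hmeas
  rw [act_apply _ _ hs, act_apply _ _ hs, act, lintegral_map hmeas_slice
    continuous_jMap.measurable, lintegral_prod_symm'
      (fun p : StateSpace d => P.map (A 1) {B | jMap (B, jMap p) ∈ s})
      (hmeas_slice.comp continuous_jMap.measurable)]
  refine lintegral_congr fun y => ?_
  have hmeas' : MeasurableSet {B : TopicalOperator d | jMap (B, y) ∈ s} :=
    (continuous_jMap_prodMk y).measurable hs
  rw [productLaw_succ hA hindep hident, Measure.map_apply continuous_comp.measurable hmeas',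
    Measure.prod_apply_symm (continuous_comp.measurable hmeas')]
  refine lintegral_congr fun M => ?_
  refine congrArg _ (Set.ext fun B => ?_)
  show jMap (B.comp M, y) ∈ s ↔ jMap (B, jMap (M, y)) ∈ s
  rw [jMap_comp]

/-- Under the memory loss property there is a stationary probability measure. -/
theorem exists_stationary [IsProbabilityMeasure P] (hA : ∀ n, Measurable (A n))
    (hindep : iIndepFun A P) (hident : ∀ n, IdentDistrib (A n) (A 1) P P)
    (hMLP : MemoryLossProperty P A) :
    ∃ ρ : Measure (ProjSpace d), IsProbabilityMeasure ρ ∧ act (P.map (A 1)) ρ = ρ := by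
  obtain ⟨N, hN, hpos⟩ := hMLP
  have hlaw := isProbabilityMeasure_productLaw (P := P) hA
  have : IsProbabilityMeasure (P.map (A 1)) := Measure.isProbabilityMeasure_map (hA 1).aemeasurable
  obtain ⟨π, hπ, hπN⟩ := exists_act_eq_self_of_isRankOne (productLaw P A N) (by
    rw [productLaw, Measure.map_apply (measurable_productUpTo hA N) measurableSet_isRankOne]
    exact hpos)
  have hN0 : (N : ℝ≥0∞) ≠ 0 := by simp; omega
  -- The sum of the laws over one period, of total mass `N`.
  set τ : Measure (ProjSpace d) := ∑ j ∈ Finset.range N, act (productLaw P A j) π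
  have hτ : τ Set.univ = N := by
    rw [Measure.finsetSum_apply]
    simp [act_apply_univ]
  have : IsFiniteMeasure τ := ⟨by rw [hτ]; exact ENNReal.natCast_lt_top N⟩
  refine ⟨(N : ℝ≥0∞)⁻¹ • τ, ⟨?_⟩, ?_⟩
  · rw [Measure.smul_apply, hτ, smul_eq_mul, ENNReal.inv_mul_cancel hN0 (ENNReal.natCast_ne_top N)]
  · rw [act_smul, act_finset_sum]
    congr 1
    simp only [← act_productLaw_succ hA hindep hident]
    -- Acting by the one-step law shifts the sum by one. Its new last term is `π`, by stationarity
    -- for the `N`-fold product, and so is the lost first term; `π` is finite and cancels.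
    have h1 := Finset.sum_range_succ (fun j => act (productLaw P A j) π) N
    rw [Finset.sum_range_succ', hπN, act_productLaw_zero] at h1
    ext s hs
    have h2 := congrArg (fun m : Measure (ProjSpace d) => m s) h1
    simp only [Measure.add_apply] at h2
    exact (ENNReal.add_left_inj (measure_ne_top π s)).1 h2

end Product

/-! ### The space of functions -/

/-- Conjugation is a bounded linear map of operators, here viewed over `ℝ` because the parameter is
real. -/
theorem contDiff_comp_comp {E F : Type*} [NormedAddCommGroup E] [NormedSpace ℂ E]
    [NormedAddCommGroup F] [NormedSpace ℂ F] (a : E →L[ℂ] F) (b : F →L[ℂ] E) {n : WithTop ℕ∞}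
    {S : ℝ → E →L[ℂ] E} (hS : ContDiff ℝ n S) : ContDiff ℝ n fun t => a ∘L S t ∘L b := by
  have h : IsBoundedLinearMap ℝ fun L : E →L[ℂ] E => a ∘L L ∘L b := by
    refine IsLinearMap.with_bound ⟨fun L L' => ?_, fun c L => ?_⟩ (‖a‖ * ‖b‖) fun L => ?_
    · ext x
      simp
    · ext x
      exact (a.restrictScalars ℝ).map_smul c (L (b x))
    · calc ‖a ∘L L ∘L b‖ ≤ ‖a‖ * (‖L‖ * ‖b‖) := (a.opNorm_comp_le _).trans
            (mul_le_mul_of_nonneg_left (L.opNorm_comp_le b) (norm_nonneg a))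
        _ = ‖a‖ * ‖b‖ * ‖L‖ := by ring
  exact h.contDiff.comp hS

section FunctionSpace

variable {d : ℕ}

/-- Equality holds because `jMap` is surjective, as the identity operator shows. -/
theorem norm_compJ (ψ : ProjSpace d →ᵇ ℂ) : ‖compJ d ψ‖ = ‖ψ‖ := by
  apply le_antisymm
  · exact (BoundedContinuousFunction.norm_le (norm_nonneg _)).2 fun p => ψ.norm_coe_le_norm _
  · refine (BoundedContinuousFunction.norm_le (norm_nonneg _)).2 fun y => ?_
    have h := (compJ d ψ).norm_coe_le_norm (TopicalOperator.id d, y)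
    have h' : compJ d ψ (TopicalOperator.id d, y) = ψ y := congrArg ψ (jMap_id y)
    rwa [h'] at h

/-- The identification of the bounded continuous functions on the projective space with
`𝓑^∞`. -/
def bInftyEquiv (d : ℕ) : (ProjSpace d →ᵇ ℂ) ≃ₗᵢ[ℂ] BInfty d :=
  LinearIsometry.equivRange ⟨compJ d, norm_compJ⟩

theorem bInftyFun_bInftyEquiv (ψ : ProjSpace d →ᵇ ℂ) (p : StateSpace d) :
    bInftyFun d (bInftyEquiv d ψ) p = ψ (jMap p) := rfl

theorem bInftyFun_apply (f : BInfty d) (p : StateSpace d) :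
    bInftyFun d f p = (bInftyEquiv d).symm f (jMap p) := by
  rw [← bInftyFun_bInftyEquiv, LinearIsometryEquiv.apply_symm_apply]

theorem norm_bInftyFun_le (f : BInfty d) (p : StateSpace d) : ‖bInftyFun d f p‖ ≤ ‖f‖ :=
  (f : StateSpace d →ᵇ ℂ).norm_coe_le_norm p

theorem continuous_bInftyFun (f : BInfty d) : Continuous (bInftyFun d f) :=
  (f : StateSpace d →ᵇ ℂ).continuous

theorem integrable_bInftyFun (ν : Measure (StateSpace d)) [IsFiniteMeasure ν] (f : BInfty d) :
    Integrable (bInftyFun d f) ν :=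
  Integrable.of_bound (continuous_bInftyFun f).aestronglyMeasurable ‖f‖
    (Filter.Eventually.of_forall (norm_bInftyFun_le f))

instance : CompleteSpace (BInfty d) :=
  (bInftyEquiv d).symm.toIsometryEquiv.completeSpace

theorem conditionH1_bInfty : ConditionH1 (bInftyFun d) where
  injective f g h := Subtype.ext (BoundedContinuousFunction.ext fun p => congrFun h p)
  complete := inferInstance
  measurable f := (continuous_bInftyFun f).measurable
  one_mem := ⟨bInftyEquiv d (BoundedContinuousFunction.const _ 1), rfl⟩
  conj_mem f := ⟨bInftyEquiv d (star ((bInftyEquiv d).symm f)), by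
    funext p
    rw [bInftyFun_bInftyEquiv, bInftyFun_apply]
    rfl⟩
  abs_mem f := ⟨bInftyEquiv d (BoundedContinuousFunction.ofNormedAddCommGroup
      (fun y => ((‖(bInftyEquiv d).symm f y‖ : ℝ) : ℂ)) (by fun_prop) ‖(bInftyEquiv d).symm f‖
      fun y => by
        rw [Complex.norm_real, norm_norm]
        exact ((bInftyEquiv d).symm f).norm_coe_le_norm y), by
    funext p
    rw [bInftyFun_bInftyEquiv, bInftyFun_apply]
    rfl⟩
  dirac_continuous p :=
    (BoundedContinuousFunction.evalCLM ℂ p).continuous.comp continuous_subtype_val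

/-- The operator on `𝓑^∞` corresponding to an operator on the bounded continuous functions on
the projective space. -/
def liftOperator (S : (ProjSpace d →ᵇ ℂ) →L[ℂ] (ProjSpace d →ᵇ ℂ)) : BInfty d →L[ℂ] BInfty d :=
  ((bInftyEquiv d).toContinuousLinearEquiv : (ProjSpace d →ᵇ ℂ) →L[ℂ] BInfty d) ∘L S ∘L
    ((bInftyEquiv d).symm.toContinuousLinearEquiv : BInfty d →L[ℂ] (ProjSpace d →ᵇ ℂ))

theorem liftOperator_apply (S : (ProjSpace d →ᵇ ℂ) →L[ℂ] (ProjSpace d →ᵇ ℂ)) (f : BInfty d) :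
    liftOperator S f = bInftyEquiv d (S ((bInftyEquiv d).symm f)) := rfl

theorem bInftyFun_liftOperator (S : (ProjSpace d →ᵇ ℂ) →L[ℂ] (ProjSpace d →ᵇ ℂ))
    (f : BInfty d) (p : StateSpace d) :
    bInftyFun d (liftOperator S f) p = S ((bInftyEquiv d).symm f) (jMap p) := rfl

theorem liftOperator_pow_apply (S : (ProjSpace d →ᵇ ℂ) →L[ℂ] (ProjSpace d →ᵇ ℂ)) (n : ℕ)
    (f : BInfty d) :
    (liftOperator S ^ n) f = bInftyEquiv d ((S ^ n) ((bInftyEquiv d).symm f)) := by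
  induction n generalizing f with
  | zero => simp
  | succ n ih =>
    rw [pow_succ, pow_succ, mul_apply_eq_comp, mul_apply_eq_comp, ih, liftOperator_apply,
      LinearIsometryEquiv.symm_apply_apply]

theorem contDiff_liftOperator {n : WithTop ℕ∞}
    {S : ℝ → (ProjSpace d →ᵇ ℂ) →L[ℂ] (ProjSpace d →ᵇ ℂ)} (hS : ContDiff ℝ n S) :
    ContDiff ℝ n fun t => liftOperator (S t) :=
  contDiff_comp_comp _ _ hS

end FunctionSpace

/-! ### The transition kernel -/

section Kernel

variable {d : ℕ} (μ : Measure (TopicalOperator d)) [IsProbabilityMeasure μ]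

theorem transitionKernel_eq_map (p : StateSpace d) :
    transitionKernel μ p = μ.map fun B => (B, jMap p) := by
  rw [transitionKernel, Kernel.prod_apply, Kernel.const_apply, Kernel.deterministic_apply,
    Measure.prod_dirac]

instance : IsMarkovKernel (transitionKernel μ) :=
  inferInstanceAs (IsMarkovKernel (Kernel.const (StateSpace d) μ ×ₖ
    Kernel.deterministic jMap continuous_jMap.measurable))

theorem integral_transitionKernel {h : StateSpace d → ℂ} (hh : Continuous h) (p : StateSpace d) :
    ∫ q, h q ∂(transitionKernel μ p) = ∫ B, h (B, jMap p) ∂μ := by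
  rw [transitionKernel_eq_map, integral_map (by fun_prop) hh.aestronglyMeasurable]

/-- From `(B, y)` of law `μ ⊗ ρ`, the chain moves to a fresh operator of law `μ`, independent of the
point `B y`, whose law is `act μ ρ = ρ`. -/
theorem invariant_prod {ρ : Measure (ProjSpace d)} [IsProbabilityMeasure ρ] (hρ : act μ ρ = ρ) :
    (transitionKernel μ).Invariant (μ.prod ρ) := by
  ext D hD
  have h : ∀ p, transitionKernel μ p D = μ ((fun B => (B, jMap p)) ⁻¹' D) := fun p => by
    rw [transitionKernel_eq_map, Measure.map_apply (by fun_prop) hD]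
  rw [Measure.bind_apply hD (Kernel.aemeasurable _), lintegral_congr h,
    ← lintegral_map (f := fun y => μ ((fun B => (B, y)) ⁻¹' D))
      (measurable_measure_prodMk_right hD) continuous_jMap.measurable, Measure.prod_apply_symm hD]
  exact congrArg (fun m => ∫⁻ y, μ ((fun B => (B, y)) ⁻¹' D) ∂m) hρ

theorem isDominatedBy_one : IsDominatedBy μ (fun _ => 1) fun _ => 1 :=
  ⟨integrable_const 1, Filter.Eventually.of_forall fun _ _ => by simp⟩

/-- The operator `ψ ↦ ∫ ψ (B ·) μ(dB)`. -/
def markovOperator : (ProjSpace d →ᵇ ℂ) →L[ℂ] (ProjSpace d →ᵇ ℂ) :=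
  weightedOperator μ (fun _ => 1) continuous_const (fun _ => 1) (isDominatedBy_one μ)

theorem markovOperator_apply (ψ : ProjSpace d →ᵇ ℂ) (y : ProjSpace d) :
    markovOperator μ ψ y = ∫ B, ψ (jMap (B, y)) ∂μ := by
  rw [markovOperator, weightedOperator_apply]
  simp only [one_mul]

theorem norm_markovOperator_le : ‖markovOperator μ‖ ≤ 1 := by
  refine (opNorm_le_of_isDominatedBy (isDominatedBy_one μ)
    (weightedOperator_apply continuous_const (isDominatedBy_one μ))).trans ?_
  simp

theorem isMarkovOperator_liftOperator :
    IsMarkovOperator (transitionKernel μ) (bInftyFun d) (liftOperator (markovOperator μ)) := by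
  refine fun f p => ⟨integrable_bInftyFun _ f, ?_⟩
  rw [bInftyFun_liftOperator, markovOperator_apply,
    integral_transitionKernel μ (continuous_bInftyFun f)]
  simp only [bInftyFun_apply]

/-- The cocycle is evaluated at the new state `(B, jMap p)`, so `Q_t f` depends on `p` only through
`jMap p` and remains in `BInfty`. -/
theorem isFourierOperator_liftOperator {φ : (Fin d → ℝ) → ℝ} (hφ : IsTopicalFunction φ) {m : ℕ}
    (hm : HasMoment μ (supCocycle φ) m) (t : ℝ) :
    IsFourierOperator (transitionKernel μ) (cocycle φ hφ) (bInftyFun d) (t : ℂ)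
      (liftOperator (fourierOperator hφ hm 0 t)) := by
  intro f p
  have hc : Continuous fun q => Complex.exp (Complex.I * t * cocycle φ hφ q) * bInftyFun d f q := by
    have h1 := continuous_cocycle φ hφ
    have h2 := continuous_bInftyFun f
    fun_prop
  refine ⟨Integrable.of_bound hc.aestronglyMeasurable ‖f‖ (Filter.Eventually.of_forall fun q => ?_),
    ?_⟩
  · rw [norm_mul, norm_exp_I_mul_mul, one_mul]
    exact norm_bInftyFun_le f q
  · rw [bInftyFun_liftOperator, fourierOperator_apply hφ hm (Nat.zero_le m),
      integral_transitionKernel μ hc]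
    simp only [bInftyFun_apply, fourierWeight, pow_zero, one_mul]

end Kernel

/-! ### The spectral gap -/

section Gap

variable {d : ℕ}

theorem integrable_comp_jMap (μ : Measure (TopicalOperator d)) [IsFiniteMeasure μ]
    (ψ : ProjSpace d →ᵇ ℂ) (y : ProjSpace d) : Integrable (fun B => ψ (jMap (B, y))) μ :=
  Integrable.of_bound (ψ.continuous.comp (continuous_jMap_prodMk y)).aestronglyMeasurable ‖ψ‖
    (Filter.Eventually.of_forall fun _ => ψ.norm_coe_le_norm _)

theorem integral_act (μ : Measure (TopicalOperator d)) [IsFiniteMeasure μ]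
    (ρ : Measure (ProjSpace d)) [IsFiniteMeasure ρ] (ψ : ProjSpace d →ᵇ ℂ) :
    ∫ y, ψ y ∂(act μ ρ) = ∫ y, ∫ B, ψ (jMap (B, y)) ∂μ ∂ρ := by
  rw [act, integral_map continuous_jMap.measurable.aemeasurable
    ψ.continuous.aestronglyMeasurable, integral_prod_symm]
  exact Integrable.of_bound (ψ.continuous.comp continuous_jMap).aestronglyMeasurable ‖ψ‖
    (Filter.Eventually.of_forall fun _ => ψ.norm_coe_le_norm _)

/-- The two integrands agree on rank one operators and differ by at most `c` elsewhere. -/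
theorem norm_integral_sub_le_of_osc (μ : Measure (TopicalOperator d)) [IsFiniteMeasure μ]
    (ψ : ProjSpace d →ᵇ ℂ) {c : ℝ} (hψ : ∀ y y', ‖ψ y - ψ y'‖ ≤ c) (y y' : ProjSpace d) :
    ‖∫ M, ψ (jMap (M, y)) ∂μ - ∫ M, ψ (jMap (M, y')) ∂μ‖ ≤ μ.real {M | M.IsRankOne}ᶜ * c := by
  have hR := (measurableSet_isRankOne (d := d)).compl
  rw [← integral_sub (integrable_comp_jMap μ ψ y) (integrable_comp_jMap μ ψ y')]
  have h : μ.real {M | M.IsRankOne}ᶜ * c =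
      ∫ M, ({M : TopicalOperator d | M.IsRankOne}ᶜ).indicator (fun _ => c) M ∂μ := by
    rw [integral_indicator_const _ hR, smul_eq_mul]
  rw [h]
  refine norm_integral_le_of_norm_le ((integrable_const c).indicator hR)
    (Filter.Eventually.of_forall fun M => ?_)
  by_cases hM : M.IsRankOne
  · rw [Set.indicator_of_notMem (by simpa using hM), hM.jMap_eq y y', sub_self, norm_zero]
  · rw [Set.indicator_of_mem (by simpa using hM)]
    exact hψ _ _

variable {Ω : Type*} [MeasurableSpace Ω] {P : Measure Ω} {A : ℕ → Ω → TopicalOperator d}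
  [IsProbabilityMeasure P]

theorem markovOperator_pow_apply (hA : ∀ n, Measurable (A n)) (hindep : iIndepFun A P)
    (hident : ∀ n, IdentDistrib (A n) (A 1) P P) [IsProbabilityMeasure (P.map (A 1))]
    (n : ℕ) (ψ : ProjSpace d →ᵇ ℂ) (y : ProjSpace d) :
    (markovOperator (P.map (A 1)) ^ n) ψ y = ∫ M, ψ (jMap (M, y)) ∂(productLaw P A n) := by
  have hlaw := isProbabilityMeasure_productLaw (P := P) hA
  have hc : ∀ ψ : ProjSpace d →ᵇ ℂ, Continuous fun M : TopicalOperator d => ψ (jMap (M, y)) :=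
    fun ψ => ψ.continuous.comp (continuous_jMap_prodMk y)
  induction n generalizing ψ with
  | zero =>
    rw [productLaw_zero, integral_dirac' _ _ (hc ψ).stronglyMeasurable, jMap_id]
    rfl
  | succ n ih =>
    -- The copy of the operator applied first to `ψ` accounts for the leftmost factor `A (n + 1)` of
    -- the product.
    rw [pow_succ, mul_apply_eq_comp, ih, productLaw_succ hA hindep hident,
      integral_map continuous_comp.measurable.aemeasurable (hc ψ).aestronglyMeasurable,
      integral_prod_symm (fun p : TopicalOperator d × TopicalOperator d =>
        ψ (jMap (p.1.comp p.2, y))) (Integrable.of_bound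
        ((hc ψ).comp continuous_comp).aestronglyMeasurable ‖ψ‖
        (Filter.Eventually.of_forall fun _ => ψ.norm_coe_le_norm _))]
    simp only [markovOperator_apply, jMap_comp]

theorem osc_markovOperator_pow_le (hA : ∀ n, Measurable (A n)) (hindep : iIndepFun A P)
    (hident : ∀ n, IdentDistrib (A n) (A 1) P P) [IsProbabilityMeasure (P.map (A 1))]
    (N k : ℕ) (ψ : ProjSpace d →ᵇ ℂ) (y y' : ProjSpace d) :
    ‖(markovOperator (P.map (A 1)) ^ (N * k)) ψ y -
        (markovOperator (P.map (A 1)) ^ (N * k)) ψ y'‖ ≤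
      (productLaw P A N).real {M | M.IsRankOne}ᶜ ^ k * (2 * ‖ψ‖) := by
  have hlaw := isProbabilityMeasure_productLaw (P := P) hA
  induction k generalizing y y' with
  | zero =>
    rw [pow_zero, one_mul, two_mul]
    exact (norm_sub_le _ _).trans (add_le_add (ψ.norm_coe_le_norm y) (ψ.norm_coe_le_norm y'))
  | succ k ih =>
    -- The outer block of `N` iterates contracts the oscillation of the inner `N * k` ones.
    rw [Nat.mul_succ, add_comm (N * k) N, pow_add, mul_apply_eq_comp,
      markovOperator_pow_apply hA hindep hident, markovOperator_pow_apply hA hindep hident,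
      pow_succ', mul_assoc]
    exact norm_integral_sub_le_of_osc _ _ ih y y'

theorem real_compl_isRankOne_lt_one (hA : ∀ n, Measurable (A n)) {N : ℕ}
    (hN : 0 < P {ω | (productUpTo (fun n => A n ω) N).IsRankOne}) :
    (productLaw P A N).real {M | M.IsRankOne}ᶜ < 1 := by
  have hlaw := isProbabilityMeasure_productLaw (P := P) hA N
  rw [probReal_compl_eq_one_sub measurableSet_isRankOne]
  have h : 0 < (productLaw P A N).real {M | M.IsRankOne} := by
    refine ENNReal.toReal_pos ?_ (measure_ne_top _ _)
    rw [productLaw, Measure.map_apply (measurable_productUpTo hA N) measurableSet_isRankOne]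
    exact hN.ne'
  linarith

theorem norm_integral_bInftyFun_le (ν : Measure (StateSpace d)) [IsProbabilityMeasure ν]
    (f : BInfty d) : ‖∫ p, bInftyFun d f p ∂ν‖ ≤ 1 * ‖f‖ := by
  refine (norm_integral_le_of_norm_le_const (Filter.Eventually.of_forall
    (norm_bInftyFun_le f))).trans_eq ?_
  rw [probReal_univ, mul_one, one_mul]

/-- The linear form on `𝓑^∞` given by a probability measure on the state space. -/
def integralForm (ν : Measure (StateSpace d)) [IsProbabilityMeasure ν] : BInfty d →L[ℂ] ℂ :=
  LinearMap.mkContinuous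
    { toFun := fun f => ∫ p, bInftyFun d f p ∂ν
      map_add' := fun f g => by
        rw [map_add]
        exact integral_add (integrable_bInftyFun ν f) (integrable_bInftyFun ν g)
      map_smul' := fun c f => by
        rw [map_smul]
        exact integral_const_mul c _ } 1 (norm_integral_bInftyFun_le ν)

theorem integralForm_apply (ν : Measure (StateSpace d)) [IsProbabilityMeasure ν] (f : BInfty d) :
    integralForm ν f = ∫ p, bInftyFun d f p ∂ν := rfl

/-- Under `μ ⊗ ρ` the law of `jMap` is `act μ ρ = ρ`. -/
theorem integralForm_prod {μ : Measure (TopicalOperator d)} [IsProbabilityMeasure μ]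
    {ρ : Measure (ProjSpace d)} [IsProbabilityMeasure ρ] (hρ : act μ ρ = ρ) (f : BInfty d) :
    integralForm (μ.prod ρ) f = ∫ y, (bInftyEquiv d).symm f y ∂ρ := by
  conv_rhs => rw [← hρ, act, integral_map continuous_jMap.measurable.aemeasurable
    ((bInftyEquiv d).symm f).continuous.aestronglyMeasurable]
  rw [integralForm_apply]
  simp only [bInftyFun_apply]

theorem hasSpectralGap_liftOperator (hA : ∀ n, Measurable (A n)) (hindep : iIndepFun A P)
    (hident : ∀ n, IdentDistrib (A n) (A 1) P P) (hMLP : MemoryLossProperty P A)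
    [IsProbabilityMeasure (P.map (A 1))] {ρ : Measure (ProjSpace d)} [IsProbabilityMeasure ρ]
    (hρ : act (P.map (A 1)) ρ = ρ) :
    HasSpectralGap (liftOperator (markovOperator (P.map (A 1))))
      (bInftyEquiv d (BoundedContinuousFunction.const _ 1))
      (integralForm ((P.map (A 1)).prod ρ)) := by
  have hS : ∀ ψ : ProjSpace d →ᵇ ℂ, ∫ y, markovOperator (P.map (A 1)) ψ y ∂ρ = ∫ y, ψ y ∂ρ := by
    intro ψ
    conv_rhs => rw [← hρ, integral_act]
    simp only [markovOperator_apply]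
  have hSn : ∀ (n : ℕ) (ψ : ProjSpace d →ᵇ ℂ),
      ∫ y, (markovOperator (P.map (A 1)) ^ n) ψ y ∂ρ = ∫ y, ψ y ∂ρ := by
    intro n
    induction n with
    | zero => exact fun ψ => rfl
    | succ n ih =>
      intro ψ
      rw [pow_succ, mul_apply_eq_comp, ih, hS]
  refine ⟨?_, ?_, ?_, ?_, ?_⟩
  · refine ContinuousLinearMap.opNorm_le_bound _ zero_le_one fun f => ?_
    rw [liftOperator_apply, LinearIsometryEquiv.norm_map]
    refine (ContinuousLinearMap.le_of_opNorm_le _ (norm_markovOperator_le _) _).trans ?_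
    rw [LinearIsometryEquiv.norm_map]
  · rw [liftOperator_apply, LinearIsometryEquiv.symm_apply_apply]
    congr 1
    ext y
    rw [markovOperator_apply]
    simp
  · rw [integralForm_prod hρ, LinearIsometryEquiv.symm_apply_apply]
    simp
  · intro f
    rw [integralForm_prod hρ, integralForm_prod hρ, liftOperator_apply,
      LinearIsometryEquiv.symm_apply_apply, hS]
  · obtain ⟨N, -, hN⟩ := hMLP
    set q := (productLaw P A N).real {M | M.IsRankOne}ᶜ
    -- The initial oscillation is at most `2 ‖ψ‖`, so any `q ^ k` below `1 / 2` would do.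
    obtain ⟨k, hk⟩ := exists_pow_lt_of_lt_one (show (0 : ℝ) < 1 / 4 by norm_num)
      (real_compl_isRankOne_lt_one hA hN)
    refine ⟨N * k, q ^ k * 2, by linarith, fun f hf => ?_⟩
    rw [liftOperator_pow_apply, LinearIsometryEquiv.norm_map,
      ← (bInftyEquiv d).symm.norm_map f]
    set ψ := (bInftyEquiv d).symm f
    rw [integralForm_prod hρ] at hf
    have hq : 0 ≤ q := measureReal_nonneg
    refine (BoundedContinuousFunction.norm_le (by positivity)).2 fun y => ?_
    set g := (markovOperator (P.map (A 1)) ^ (N * k)) ψ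
    have hg : Integrable (fun y' => g y') ρ :=
      Integrable.of_bound g.continuous.aestronglyMeasurable ‖g‖
        (Filter.Eventually.of_forall g.norm_coe_le_norm)
    -- `g` has zero mean, like `ψ`, so its values are averages of its differences and are bounded by
    -- its oscillation.
    have h1 : g y = ∫ y', (g y - g y') ∂ρ := by
      rw [integral_sub (integrable_const _) hg, hSn, hf]
      simp
    rw [h1, mul_assoc]
    refine (norm_integral_le_of_norm_le_const (Filter.Eventually.of_forall
      (osc_markovOperator_pow_le hA hindep hident N k ψ y))).trans_eq ?_
    rw [probReal_univ, mul_one]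

end Gap

/-! ### The moment condition for the law of `A 1`, and the conclusion -/

theorem HasMoment.map {Ω : Type*} [MeasurableSpace Ω] {P : Measure Ω} {d m : ℕ}
    {B : Ω → TopicalOperator d} (hB : Measurable B) {φ : (Fin d → ℝ) → ℝ}
    (hφ : IsTopicalFunction φ) (h : HasMoment P (fun ω => supCocycle φ (B ω)) m) :
    HasMoment (P.map B) (supCocycle φ) m := by
  have hs := measurable_supCocycle hφ
  refine ⟨?_, ?_⟩
  · rw [ae_map_iff hB.aemeasurable (measurableSet_lt hs measurable_const)]
    exact h.1
  · rw [lintegral_map (hs.pow_const m) hB]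
    exact h.2

end IteratedTopical

end

open MeasureTheory ProbabilityTheory IteratedTopical in
theorem mainTheorem12 {Ω : Type*} [MeasurableSpace Ω] (P : Measure Ω) [IsProbabilityMeasure P]
    (d m : ℕ) (A : ℕ → Ω → TopicalOperator d) (hmeas : ∀ n, Measurable (A n))
    (hindep : iIndepFun A P) (hident : ∀ n, IdentDistrib (A n) (A 1) P P)
    (hMLP : MemoryLossProperty P A)
    (φ : (Fin d → ℝ) → ℝ) (hφ : IsTopicalFunction φ)
    (hmoment : HasMoment P (fun ω => supCocycle φ (A 1 ω)) m) :
    ConditionH (transitionKernel (P.map (A 1))) (cocycle φ hφ) (bInftyFun d) m ∧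
      ConditionHWith (transitionKernel (P.map (A 1))) (cocycle φ hφ) (bInftyFun d) m Set.univ ∧
      ∃ T : BInfty d →L[ℂ] BInfty d,
        IsMarkovOperator (transitionKernel (P.map (A 1))) (bInftyFun d) T ∧
          spectralRadius ℂ T = 1 ∧ peripheralDim T = 1 := by
  have : IsProbabilityMeasure (P.map (A 1)) :=
    Measure.isProbabilityMeasure_map (hmeas 1).aemeasurable
  obtain ⟨ρ, _, hρ⟩ := exists_stationary hmeas hindep hident hMLP
  have hgap := hasSpectralGap_liftOperator hmeas hindep hident hMLP hρ
  have hm := hmoment.map (hmeas 1) hφ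
  have hT := isMarkovOperator_liftOperator (P.map (A 1))
  have key : ConditionHWith (transitionKernel (P.map (A 1))) (cocycle φ hφ) (bInftyFun d) m
      Set.univ :=
    { markov := inferInstance
      measurable := (continuous_cocycle φ hφ).measurable
      h1 := conditionH1_bInfty
      h2 := ⟨⟨(P.map (A 1)).prod ρ, inferInstance, invariant_prod _ hρ, integrable_bInftyFun _,
        (integralForm ((P.map (A 1)).prod ρ)).continuous⟩, _, hT, hgap.isQuasiCompact,
        ⟨1, hgap.norm_pow_le⟩, hgap.finrank_eigenspace_one⟩
      isOpen := isOpen_univ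
      interval := Set.ordConnected_univ
      zero_mem := Set.mem_univ 0
      h3 := ⟨fun t => liftOperator (fourierOperator hφ hm 0 t),
        fun t _ => isFourierOperator_liftOperator _ hφ hm t,
        (contDiff_liftOperator (contDiff_fourierOperator hφ hm)).contDiffOn⟩ }
  exact ⟨⟨Set.univ, key⟩, key, _, hT, hgap.spectralRadius_eq_one, hgap.peripheralDim_eq_one⟩
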